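/- Let $P$ be a bounded $n$-dimensional convex polytope in hyperbolic space $\mathbb{H}^n$ (a bounded intersection of finitely many closed half-spaces, with nonempty interior). Assume that $P$ is right-angled (all its dihedral angles equal $\pi/2$) and regular, meaning that the group of isometries of $\mathbb{H}^n$ preserving $P$ acts transitively on the top-dimensional simplices of the barycentric subdivision of $P$ (equivalently, on the chains $F_0\subset F_1\subset\dots\subset F_n=P$ of faces with $\dim F_i=i$). Let $L$ be the length of an edge of $P$, and let $F$ and $F'$ be two non-adjacent facets (codimension-one faces) of $P$, that is, $F\cap F'=\emptyset$. If $\gamma:[0,1]\to P$ is a continuous path with $\gamma(0)\in F$ and $\gamma(1)\in F'$, then the length of $\gamma$ (possibly $\infty$) is at least $L$; and if it is equal to $L$, then $\gamma$ is an edge of $P$, i.e. its image is an edge of $P$. -/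

import Mathlib

/-- The vector space `ℝ^{1,n}`: one time coordinate and `n` space coordinates. -/
abbrev MinkowskiSpace (n : ℕ) : Type := ℝ × EuclideanSpace ℝ (Fin n)

/-- The Lorentz form of signature `(n, 1)`: `⟨u, v⟩ = u₁ v₁ + ⋯ + uₙ vₙ - u₀ v₀`. -/
noncomputable def lorentz {n : ℕ} (u v : MinkowskiSpace n) : ℝ :=
  inner ℝ u.2 v.2 - u.1 * v.1

/-- Hyperbolic `n`-space in the hyperboloid model:
the upper sheet of `{x | ⟨x, x⟩ = -1}`. -/
@[ext]
structure HyperbolicSpace (n : ℕ) where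
  /-- the position vector -/
  vec : MinkowskiSpace n
  lorentz_self : lorentz vec vec = -1
  time_pos : 0 < vec.1

namespace HyperbolicSpace

variable {n : ℕ}

theorem lorentz_comm (u v : MinkowskiSpace n) : lorentz u v = lorentz v u := by
  simp only [lorentz, real_inner_comm, mul_comm]

theorem lorentz_add_left (u v w : MinkowskiSpace n) :
    lorentz (u + v) w = lorentz u w + lorentz v w := by
  simp only [lorentz, Prod.fst_add, Prod.snd_add, inner_add_left]; ring

theorem lorentz_smul_left (t : ℝ) (v w : MinkowskiSpace n) :
    lorentz (t • v) w = t * lorentz v w := by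
  simp only [lorentz, Prod.smul_fst, Prod.smul_snd, real_inner_smul_left, smul_eq_mul]; ring

theorem lorentz_add_right (u v w : MinkowskiSpace n) :
    lorentz u (v + w) = lorentz u v + lorentz u w := by
  rw [lorentz_comm, lorentz_add_left, lorentz_comm v, lorentz_comm w]

theorem lorentz_smul_right (t : ℝ) (v w : MinkowskiSpace n) :
    lorentz v (t • w) = t * lorentz v w := by
  rw [lorentz_comm, lorentz_smul_left, lorentz_comm]

theorem space_sq (y : HyperbolicSpace n) : ‖y.vec.2‖ ^ 2 = y.vec.1 ^ 2 - 1 := by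
  have h := y.lorentz_self
  simp only [lorentz, real_inner_self_eq_norm_sq] at h
  nlinarith

/-- For `w` orthogonal to a point `y` of hyperbolic space, `w₀² ≤ y₀² ⟨w, w⟩`. -/
theorem time_sq_le (y : HyperbolicSpace n) (w : MinkowskiSpace n) (h : lorentz w y.vec = 0) :
    w.1 ^ 2 ≤ y.vec.1 ^ 2 * lorentz w w := by
  have h1 := y.space_sq
  have h2 : inner ℝ w.2 y.vec.2 = w.1 * y.vec.1 := by
    simp only [lorentz] at h; linarith
  have h3 := real_inner_mul_inner_self_le w.2 y.vec.2
  rw [real_inner_self_eq_norm_sq, real_inner_self_eq_norm_sq, h1, h2] at h3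
  simp only [lorentz, real_inner_self_eq_norm_sq]
  nlinarith [sq_nonneg ‖w.2‖]

theorem lorentz_self_nonneg (y : HyperbolicSpace n) (w : MinkowskiSpace n)
    (h : lorentz w y.vec = 0) : 0 ≤ lorentz w w := by
  have h1 := time_sq_le y w h
  have h2 : 0 < y.vec.1 ^ 2 := pow_pos y.time_pos 2
  by_contra! h3
  nlinarith [sq_nonneg w.1, mul_pos_of_neg_of_neg h3 (neg_lt_zero.mpr h2)]

/-- The Cauchy-Schwarz inequality on the orthogonal complement of a point. -/
theorem lorentz_sq_le (y : HyperbolicSpace n) (v w : MinkowskiSpace n)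
    (hv : lorentz v y.vec = 0) (hw : lorentz w y.vec = 0) :
    lorentz v w ^ 2 ≤ lorentz v v * lorentz w w := by
  have key : ∀ t : ℝ, 0 ≤ lorentz w w * (t * t) + (2 * lorentz v w) * t + lorentz v v := by
    intro t
    have h := lorentz_self_nonneg y (v + t • w) (by
      rw [lorentz_add_left, lorentz_smul_left, hv, hw]; ring)
    rw [lorentz_add_left, lorentz_add_right, lorentz_add_right, lorentz_smul_left,
      lorentz_smul_left, lorentz_smul_right, lorentz_smul_right, lorentz_comm w v] at h
    linarith
  have h := discrim_le_zero key
  rw [discrim] at h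
  nlinarith

theorem one_le_neg_lorentz (x y : HyperbolicSpace n) : 1 ≤ -lorentz x.vec y.vec := by
  have hx := x.space_sq
  have hy := y.space_sq
  have hx0 := x.time_pos
  have hy0 := y.time_pos
  have h := real_inner_le_norm x.vec.2 y.vec.2
  simp only [lorentz]
  set a := x.vec.1
  set b := y.vec.1
  have h1 : ‖x.vec.2‖ * ‖y.vec.2‖ ≤ a * b - 1 := by
    have hab : 1 ≤ a * b := by
      have : 1 ≤ a := by nlinarith [sq_nonneg ‖x.vec.2‖]
      have : 1 ≤ b := by nlinarith [sq_nonneg ‖y.vec.2‖]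
      nlinarith
    apply le_of_sq_le_sq _ (by linarith)
    rw [mul_pow, hx, hy]
    nlinarith [sq_nonneg (a - b)]
  linarith

/-- The hyperbolic distance: `cosh (dist x y) = -⟨x, y⟩`. -/
noncomputable instance : Dist (HyperbolicSpace n) where
  dist x y := Real.arcosh (-lorentz x.vec y.vec)

theorem dist_eq (x y : HyperbolicSpace n) :
    dist x y = Real.arcosh (-lorentz x.vec y.vec) := rfl

theorem cosh_dist (x y : HyperbolicSpace n) :
    Real.cosh (dist x y) = -lorentz x.vec y.vec :=
  Real.cosh_arcosh (one_le_neg_lorentz x y)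

theorem lorentz_component (x y z : HyperbolicSpace n) :
    lorentz (x.vec + lorentz x.vec y.vec • y.vec) (z.vec + lorentz z.vec y.vec • y.vec)
      = lorentz x.vec z.vec + lorentz x.vec y.vec * lorentz z.vec y.vec := by
  rw [lorentz_add_left, lorentz_add_right, lorentz_add_right, lorentz_smul_left,
    lorentz_smul_left, lorentz_smul_right, lorentz_smul_right, lorentz_comm y.vec z.vec,
    y.lorentz_self]
  ring

theorem lorentz_component_orth (x y : HyperbolicSpace n) :
    lorentz (x.vec + lorentz x.vec y.vec • y.vec) y.vec = 0 := by
  rw [lorentz_add_left, lorentz_smul_left, y.lorentz_self]; ring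

theorem hdist_triangle (x y z : HyperbolicSpace n) : dist x z ≤ dist x y + dist y z := by
  have hA := one_le_neg_lorentz x y
  have hB := one_le_neg_lorentz y z
  have hn : 0 ≤ dist x y + dist y z :=
    add_nonneg (Real.arcosh_nonneg hA) (Real.arcosh_nonneg hB)
  have hn' : 0 ≤ dist x z := Real.arcosh_nonneg (one_le_neg_lorentz x z)
  rw [← abs_of_nonneg hn, ← abs_of_nonneg hn', ← Real.cosh_le_cosh, Real.cosh_add,
    cosh_dist, cosh_dist, cosh_dist, dist_eq, dist_eq, Real.sinh_arcosh hA, Real.sinh_arcosh hB]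
  have h := lorentz_sq_le y _ _ (lorentz_component_orth x y) (lorentz_component_orth z y)
  rw [lorentz_component, lorentz_component, lorentz_component, x.lorentz_self,
    z.lorentz_self, lorentz_comm z.vec y.vec] at h
  rw [← Real.sqrt_mul (by nlinarith)]
  set A := lorentz x.vec y.vec
  set B := lorentz y.vec z.vec
  set C := lorentz x.vec z.vec
  have h2 : -(C + A * B) ≤ √(((-A) ^ 2 - 1) * ((-B) ^ 2 - 1)) := by
    apply Real.le_sqrt_of_sq_le
    nlinarith
  linarith

theorem eq_of_hdist_eq_zero {x y : HyperbolicSpace n} (h : dist x y = 0) : x = y := by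
  have h1 : lorentz x.vec y.vec = -1 := by
    have := cosh_dist x y
    rw [h, Real.cosh_zero] at this
    linarith
  have h2 := lorentz_component x y x
  have h3 := time_sq_le y _ (lorentz_component_orth x y)
  rw [h2, h1, x.lorentz_self] at h3
  have h4 : x.vec.1 = y.vec.1 := by
    have : (x.vec + (-1 : ℝ) • y.vec).1 = 0 := by
      apply pow_eq_zero_iff (two_ne_zero) |>.mp
      apply le_antisymm _ (sq_nonneg _)
      linarith
    simp only [Prod.fst_add, Prod.smul_fst, smul_eq_mul] at this
    linarith
  have h5 : x.vec.2 = y.vec.2 := by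
    rw [← sub_eq_zero, ← norm_eq_zero, ← pow_eq_zero_iff two_ne_zero, norm_sub_sq_real,
      space_sq, space_sq]
    have : inner ℝ x.vec.2 y.vec.2 = x.vec.1 * y.vec.1 - 1 := by
      simp only [lorentz] at h1; linarith
    rw [this, h4]; ring
  exact HyperbolicSpace.ext (Prod.ext h4 h5)

noncomputable instance : MetricSpace (HyperbolicSpace n) where
  dist_self x := by rw [dist_eq, x.lorentz_self]; simp
  dist_comm x y := by rw [dist_eq, dist_eq, lorentz_comm]
  dist_triangle := hdist_triangle
  eq_of_dist_eq_zero := eq_of_hdist_eq_zero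

/-- A unit space-like vector. These are the unit normals of the hyperplanes of `ℍⁿ`. -/
def IsUnitNormal (u : MinkowskiSpace n) : Prop := lorentz u u = 1

/-- The hyperplane of `ℍⁿ` with unit normal `u`. -/
def hyperplane (u : MinkowskiSpace n) : Set (HyperbolicSpace n) :=
  {x | lorentz x.vec u = 0}

/-- The closed half-space of `ℍⁿ` bounded by `hyperplane u`, with outward normal `u`. -/
def halfSpace (u : MinkowskiSpace n) : Set (HyperbolicSpace n) :=
  {x | lorentz x.vec u ≤ 0}

/-- A bounded `n`-dimensional convex polytope in `ℍⁿ`: a bounded finite intersection of closed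
half-spaces, with nonempty interior. -/
def IsConvexPolytope (P : Set (HyperbolicSpace n)) : Prop :=
  (∃ U : Finset (MinkowskiSpace n), (∀ u ∈ U, IsUnitNormal u) ∧ P = ⋂ u ∈ U, halfSpace u) ∧
    Bornology.IsBounded P ∧ (interior P).Nonempty

/-- `F` is a nonempty face of `P`: either `P` itself, or the nonempty intersection of `P` with a
supporting hyperplane. -/
def IsFace (P F : Set (HyperbolicSpace n)) : Prop :=
  F.Nonempty ∧
    (F = P ∨ ∃ u : MinkowskiSpace n, IsUnitNormal u ∧ P ⊆ halfSpace u ∧ F = P ∩ hyperplane u)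

/-- `F` is a face of dimension `d`: the hyperbolic subspace spanned by `F` is the intersection
of `ℍⁿ` with a linear subspace of dimension `d + 1`. -/
def IsFaceOfDim (P F : Set (HyperbolicSpace n)) (d : ℕ) : Prop :=
  IsFace P F ∧ Module.finrank ℝ (Submodule.span ℝ (vec '' F)) = d + 1

/-- A facet is a face of codimension one. -/
def IsFacet (P F : Set (HyperbolicSpace n)) : Prop :=
  ∃ d : ℕ, d + 1 = n ∧ IsFaceOfDim P F d

/-- A ridge is a face of codimension two. -/
def IsRidge (P R : Set (HyperbolicSpace n)) : Prop :=
  ∃ d : ℕ, d + 2 = n ∧ IsFaceOfDim P R d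

/-- An edge is a face of dimension one. -/
def IsEdge (P E : Set (HyperbolicSpace n)) : Prop := IsFaceOfDim P E 1

/-- The length of an edge. An edge is a compact geodesic segment, so this is the distance
between its endpoints. -/
noncomputable def edgeLength (E : Set (HyperbolicSpace n)) : ℝ := Metric.diam E

/-- `u` is the outward unit normal of `P` along the facet `F`. -/
def IsOutwardNormal (P F : Set (HyperbolicSpace n)) (u : MinkowskiSpace n) : Prop :=
  IsUnitNormal u ∧ P ⊆ halfSpace u ∧ F = P ∩ hyperplane u

/-- The interior angle between two half-spaces with outward unit normals `u` and `v` and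
intersecting boundary hyperplanes. -/
noncomputable def dihedralAngle (u v : MinkowskiSpace n) : ℝ := Real.arccos (-lorentz u v)

/-- All dihedral angles of `P`, i.e. the angles along the ridges of `P` between the two facets
containing the ridge, are equal to `π / 2`. -/
def IsRightAngled (P : Set (HyperbolicSpace n)) : Prop :=
  ∀ F F' : Set (HyperbolicSpace n), IsFacet P F → IsFacet P F' → IsRidge P (F ∩ F') →
    ∀ u u' : MinkowskiSpace n, IsOutwardNormal P F u → IsOutwardNormal P F' u' →
      dihedralAngle u u' = Real.pi / 2

/-- A top-dimensional simplex of the barycentric subdivision of `P`, given as usual by the chain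
`F₀ ⊂ F₁ ⊂ ⋯ ⊂ Fₙ = P` of faces, one in each dimension, whose barycenters are its vertices. -/
structure BarycentricSimplex (P : Set (HyperbolicSpace n)) where
  /-- the face whose barycenter is the `i`-th vertex -/
  face : Fin (n + 1) → Set (HyperbolicSpace n)
  isFaceOfDim : ∀ i, IsFaceOfDim P (face i) i
  mono : Monotone face

/-- `P` is regular: its symmetry group (the group of isometries of `ℍⁿ` preserving `P`) acts
transitively on the top-dimensional simplices of the barycentric subdivision of `P`. -/
def IsRegular (P : Set (HyperbolicSpace n)) : Prop :=
  ∀ σ τ : BarycentricSimplex P, ∃ g : HyperbolicSpace n ≃ᵢ HyperbolicSpace n,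
    g '' P = P ∧ ∀ i, g '' (σ.face i) = τ.face i

/-- The length of a path: the supremum, over all partitions of `[0, 1]`, of the sums of the
distances between consecutive points. It is `∞` for a non-rectifiable path. -/
noncomputable def pathLength {x y : HyperbolicSpace n} (γ : Path x y) : ENNReal :=
  eVariationOn γ Set.univ

end HyperbolicSpace

/-! ### Algebra of the Lorentz form -/

namespace HyperbolicSpace

variable {n : ℕ}

/-! Describe `P` by the unit normals `U` of its facets. Right angles imply that distinct normals
satisfy `⟨u, w⟩ ≤ 0` (`acute_of_isRightAngled`), with `⟨u, w⟩ = 0` as soon as the hyperplanes meet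
(`lorentz_eq_zero_of_isRightAngled`). Hence the faces are the nonempty sets `face U S`, with `S`
orthonormal, and the normals of the facets of such a face are elements of `U` orthogonal to `S`. So
the number `⟨a, b⟩` is the same whether the walls `a` and `b` are viewed in `P` or in a smaller
face.

The heart is the bound `cosh L ≤ -⟨a, b⟩` for disjoint facets (`cosh_le_of_disjoint`), by descent
through faces. In a face `Q`, fix `a` and let `b` maximize `⟨a, b⟩` among the facets of `Q` disjoint
from `a`. Regularity provides a vector `c` with the same nonzero product with all facet normals of
`Q` (`exists_center`). If no neighbour `w` of `b` in `Q` had `⟨a, w⟩ > ⟨a, b⟩`, then `a - (⟨a, b⟩ /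
⟨c, b⟩) c` would lie in the cone over the facet `b`, so its product with `a` would be nonpositive;
but that product is `1 - ⟨a, b⟩ ≥ 1` (`exists_link_lt`). The neighbour so obtained must meet `a`, by
the choice of `b`, and `a`, `b` cut out disjoint facets of `Q ∩ w`, which has one dimension less.
The descent ends at an edge, where `cosh_diam_le_of_edge` applies; all edges have length `L` by
regularity.

Two Cauchy-Schwarz inequalities give `-⟨a, b⟩ ≤ cosh (dist x y)`, hence the bound on the path. If
the length is `L`, the descent yields an edge with `a` and `b` among its walls, equality in
Cauchy-Schwarz puts `x` and `y` on the line of that edge, the sharp triangle inequality keeps the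
path there, and continuity makes it cover the edge. -/

theorem lorentz_neg_left (u v : MinkowskiSpace n) : lorentz (-u) v = -lorentz u v := by
  simpa using lorentz_smul_left (-1) u v

theorem lorentz_neg_right (u v : MinkowskiSpace n) : lorentz u (-v) = -lorentz u v := by
  rw [lorentz_comm, lorentz_neg_left, lorentz_comm]

theorem lorentz_sub_left (u v w : MinkowskiSpace n) :
    lorentz (u - v) w = lorentz u w - lorentz v w := by
  rw [sub_eq_add_neg, lorentz_add_left, lorentz_neg_left, sub_eq_add_neg]

theorem lorentz_sub_right (u v w : MinkowskiSpace n) :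
    lorentz u (v - w) = lorentz u v - lorentz u w := by
  rw [sub_eq_add_neg, lorentz_add_right, lorentz_neg_right, sub_eq_add_neg]

@[simp]
theorem lorentz_zero_left (v : MinkowskiSpace n) : lorentz 0 v = 0 := by
  simpa using lorentz_smul_left 0 0 v

@[simp]
theorem lorentz_zero_right (v : MinkowskiSpace n) : lorentz v 0 = 0 := by
  rw [lorentz_comm, lorentz_zero_left]

/-- The Lorentz form as a bilinear form. -/
noncomputable def lorentzForm (n : ℕ) : LinearMap.BilinForm ℝ (MinkowskiSpace n) :=
  LinearMap.mk₂ ℝ lorentz lorentz_add_left lorentz_smul_left lorentz_add_right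
    (fun t u v => lorentz_smul_right t u v)

@[simp]
theorem lorentzForm_apply (u v : MinkowskiSpace n) : lorentzForm n u v = lorentz u v := rfl

theorem lorentz_sum_left {ι : Type*} (s : Finset ι) (f : ι → MinkowskiSpace n)
    (v : MinkowskiSpace n) : lorentz (∑ i ∈ s, f i) v = ∑ i ∈ s, lorentz (f i) v := by
  simp only [← lorentzForm_apply, map_sum, LinearMap.sum_apply]

theorem lorentz_sum_right {ι : Type*} (s : Finset ι) (f : ι → MinkowskiSpace n)
    (v : MinkowskiSpace n) : lorentz v (∑ i ∈ s, f i) = ∑ i ∈ s, lorentz v (f i) := by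
  simp only [← lorentzForm_apply, map_sum]

theorem eq_zero_of_forall_lorentz {u : MinkowskiSpace n} (h : ∀ v, lorentz u v = 0) : u = 0 := by
  -- Reversing time in the second argument turns the form into the Euclidean square norm of `u`.
  have h1 := h (-u.1, u.2)
  simp only [lorentz, real_inner_self_eq_norm_sq] at h1
  have h2 : u.1 = 0 := by nlinarith [sq_nonneg ‖u.2‖, sq_nonneg u.1]
  have h3 : u.2 = 0 := by
    rw [← norm_eq_zero]
    nlinarith [sq_nonneg ‖u.2‖, sq_nonneg u.1]
  exact Prod.ext h2 h3

theorem lorentzForm_isRefl : (lorentzForm n).IsRefl := by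
  intro u v h
  rw [lorentzForm_apply] at h ⊢
  rw [lorentz_comm, h]

theorem lorentzForm_nondegenerate : (lorentzForm n).Nondegenerate := by
  refine lorentzForm_isRefl.nondegenerate_iff_separatingLeft.mpr ?_
  intro u h
  exact eq_zero_of_forall_lorentz h

/-- A vector orthogonal to a point and of zero norm vanishes. -/
theorem eq_zero_of_lorentz_self (y : HyperbolicSpace n) {w : MinkowskiSpace n}
    (h : lorentz w y.vec = 0) (h0 : lorentz w w = 0) : w = 0 := by
  have h1 := time_sq_le y w h
  rw [h0, mul_zero] at h1
  have h2 : w.1 = 0 := by nlinarith [sq_nonneg w.1]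
  have h3 : w.2 = 0 := by
    simp only [lorentz, real_inner_self_eq_norm_sq, h2] at h0
    rw [← norm_eq_zero]
    nlinarith
  exact Prod.ext h2 h3

theorem lorentz_self_pos (y : HyperbolicSpace n) {w : MinkowskiSpace n}
    (h : lorentz w y.vec = 0) (h0 : w ≠ 0) : 0 < lorentz w w :=
  lt_of_le_of_ne (lorentz_self_nonneg y w h) fun h1 => h0 (eq_zero_of_lorentz_self y h h1.symm)

theorem lorentz_vec_neg (x y : HyperbolicSpace n) : lorentz x.vec y.vec < 0 := by
  linarith [one_le_neg_lorentz x y]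

theorem vec_ne_zero (x : HyperbolicSpace n) : x.vec ≠ 0 := by
  intro h
  have := x.lorentz_self
  rw [h, lorentz_zero_left] at this
  linarith

/-! ### Points obtained from time-like vectors -/

/-- A time-like vector on the future side of a point is a positive multiple of a point. -/
theorem exists_smul_vec {v : MinkowskiSpace n} (hv : lorentz v v < 0) (x : HyperbolicSpace n)
    (hx : lorentz v x.vec < 0) : ∃ y : HyperbolicSpace n, ∃ r : ℝ, 0 < r ∧ v = r • y.vec := by
  have hpos : 0 < v.1 := by
    by_contra! h0
    have h1 := x.space_sq
    have h2 : ‖v.2‖ ^ 2 ≤ v.1 ^ 2 := by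
      simp only [lorentz, real_inner_self_eq_norm_sq] at hv
      nlinarith
    have h3 : ‖v.2‖ ≤ -v.1 := by
      apply le_of_sq_le_sq _ (by linarith)
      rwa [neg_sq]
    have h4 : ‖x.vec.2‖ ≤ x.vec.1 := by
      apply le_of_sq_le_sq _ x.time_pos.le
      linarith
    have h5 := neg_le_of_abs_le (abs_real_inner_le_norm v.2 x.vec.2)
    have h6 : ‖v.2‖ * ‖x.vec.2‖ ≤ -v.1 * x.vec.1 :=
      mul_le_mul h3 h4 (norm_nonneg _) (by linarith)
    simp only [lorentz] at hx
    linarith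
  set r := √(-lorentz v v) with hr
  have hr0 : 0 < r := Real.sqrt_pos.mpr (by linarith)
  have hrr : r * r = -lorentz v v := Real.mul_self_sqrt (by linarith)
  refine ⟨⟨r⁻¹ • v, ?_, ?_⟩, r, hr0, ?_⟩
  · rw [lorentz_smul_left, lorentz_smul_right]
    field_simp
    nlinarith
  · simp only [Prod.smul_fst, smul_eq_mul]
    positivity
  · simp [smul_smul, hr0.ne']

theorem exists_smul_vec_of_nonneg (x y : HyperbolicSpace n) {a b : ℝ} (ha : 0 < a) (hb : 0 ≤ b) :
    ∃ z : HyperbolicSpace n, ∃ r : ℝ, 0 < r ∧ a • x.vec + b • y.vec = r • z.vec := by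
  have h1 := lorentz_vec_neg x y
  have h2 := lorentz_vec_neg y x
  apply exists_smul_vec _ x
  · rw [lorentz_add_left, lorentz_smul_left, lorentz_smul_left, x.lorentz_self]
    nlinarith
  · simp only [lorentz_add_left, lorentz_smul_left, lorentz_add_right, lorentz_smul_right,
      x.lorentz_self, y.lorentz_self]
    nlinarith [mul_nonneg ha.le hb, mul_pos ha ha, mul_nonneg hb hb]

/-- The projection of a point to the orthogonal complement of a space-like unit vector. -/
theorem exists_smul_vec_proj (x : HyperbolicSpace n) {u : MinkowskiSpace n}
    (hu : lorentz u u = 1) : ∃ y : HyperbolicSpace n, ∃ r : ℝ, 0 < r ∧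
      x.vec - lorentz x.vec u • u = r • y.vec := by
  apply exists_smul_vec _ x
  · simp only [lorentz_sub_left, lorentz_smul_left, x.lorentz_self, lorentz_comm u x.vec]
    nlinarith [sq_nonneg (lorentz x.vec u)]
  · simp only [lorentz_sub_left, lorentz_smul_left, lorentz_sub_right, lorentz_smul_right,
      x.lorentz_self, lorentz_comm u x.vec, hu]
    nlinarith [sq_nonneg (lorentz x.vec u)]

open Filter Topology in
/-- Small perturbations of a point stay future time-like and keep strict inequalities. -/
theorem exists_perturbation (x : HyperbolicSpace n) (z : MinkowskiSpace n)
    (W : Finset (MinkowskiSpace n)) (hW : ∀ w ∈ W, lorentz x.vec w < 0) :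
    ∃ ε : ℝ, 0 < ε ∧ ∃ y : HyperbolicSpace n, ∃ r : ℝ, 0 < r ∧ x.vec + ε • z = r • y.vec ∧
      ∀ w ∈ W, lorentz y.vec w < 0 := by
  have key : ∀ g : ℝ → ℝ, Continuous g → g 0 < 0 → ∀ᶠ ε in 𝓝[>] (0 : ℝ), g ε < 0 :=
    fun g hg h0 => (hg.tendsto 0).eventually_lt_const h0 |>.filter_mono nhdsWithin_le_nhds
  have h1 : ∀ᶠ ε in 𝓝[>] (0 : ℝ), lorentz (x.vec + ε • z) (x.vec + ε • z) < 0 := by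
    apply key
    · unfold lorentz
      fun_prop
    · simp [x.lorentz_self]
  have h2 : ∀ᶠ ε in 𝓝[>] (0 : ℝ), lorentz (x.vec + ε • z) x.vec < 0 := by
    apply key
    · unfold lorentz
      fun_prop
    · simp [x.lorentz_self]
  have h3 : ∀ᶠ ε in 𝓝[>] (0 : ℝ), ∀ w ∈ W, lorentz (x.vec + ε • z) w < 0 := by
    rw [Filter.eventually_all_finset]
    intro w hw
    apply key
    · unfold lorentz
      fun_prop
    · simpa using hW w hw
  obtain ⟨ε, ⟨h1, h2, h3⟩, h4⟩ := ((h1.and (h2.and h3)).and self_mem_nhdsWithin).exists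
  obtain ⟨y, r, hr, hy⟩ := exists_smul_vec h1 x h2
  refine ⟨ε, h4, y, r, hr, hy, fun w hw => ?_⟩
  have := h3 w hw
  rw [hy, lorentz_smul_left] at this
  exact (pos_iff_neg_of_mul_neg this).mp hr

/-! ### Orthogonal complements and spans -/

/-- The orthogonal complement of a finite set of vectors. -/
def perp (S : Finset (MinkowskiSpace n)) : Submodule ℝ (MinkowskiSpace n) where
  carrier := {z | ∀ w ∈ S, lorentz z w = 0}
  add_mem' h h' w hw := by rw [lorentz_add_left, h w hw, h' w hw, add_zero]
  zero_mem' w _ := lorentz_zero_left w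
  smul_mem' t z h w hw := by rw [lorentz_smul_left, h w hw, mul_zero]

theorem mem_perp {S : Finset (MinkowskiSpace n)} {z : MinkowskiSpace n} :
    z ∈ perp S ↔ ∀ w ∈ S, lorentz z w = 0 := Iff.rfl

theorem finrank_minkowskiSpace : Module.finrank ℝ (MinkowskiSpace n) = n + 1 := by
  simp [MinkowskiSpace, add_comm]

theorem perp_eq_orthogonal (S : Finset (MinkowskiSpace n)) :
    perp S = (lorentzForm n).orthogonal (Submodule.span ℝ (S : Set (MinkowskiSpace n))) := by
  ext z
  rw [LinearMap.BilinForm.mem_orthogonal_iff, mem_perp]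
  constructor
  · intro h w hw
    induction hw using Submodule.span_induction with
    | mem w hw =>
      rw [lorentzForm_apply, lorentz_comm]
      exact h w hw
    | zero => simp
    | add a b _ _ ha hb =>
      rw [map_add, LinearMap.add_apply, ha, hb, add_zero]
    | smul t a _ ha =>
      rw [map_smul, LinearMap.smul_apply, ha, smul_zero]
  · intro h w hw
    rw [lorentz_comm]
    exact h w (Submodule.subset_span hw)

theorem finrank_perp {S : Finset (MinkowskiSpace n)}
    (hS : LinearIndependent ℝ (fun u : S => (u : MinkowskiSpace n))) :
    Module.finrank ℝ (perp S) + S.card = n + 1 := by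
  have h1 := LinearMap.BilinForm.finrank_orthogonal (lorentzForm_nondegenerate (n := n))
    (Submodule.span ℝ (S : Set (MinkowskiSpace n)))
  have h2 : Module.finrank ℝ (Submodule.span ℝ (S : Set (MinkowskiSpace n))) = S.card :=
    finrank_span_finset_eq_card hS
  have h3 := Submodule.finrank_le (Submodule.span ℝ (S : Set (MinkowskiSpace n)))
  rw [← perp_eq_orthogonal] at h1
  rw [finrank_minkowskiSpace] at h1 h3
  omega

theorem linearIndependent_of_orthonormal {S : Finset (MinkowskiSpace n)}
    (h1 : ∀ u ∈ S, lorentz u u = 1)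
    (h0 : ∀ u ∈ S, ∀ w ∈ S, u ≠ w → lorentz u w = 0) :
    LinearIndependent ℝ (fun u : S => (u : MinkowskiSpace n)) := by
  rw [Fintype.linearIndependent_iff]
  intro g hg w
  have h := congrArg (fun z => lorentz z w.1) hg
  simp only [lorentz_sum_left, lorentz_smul_left, lorentz_zero_left] at h
  rw [Finset.sum_eq_single w] at h
  · rwa [h1 w w.2, mul_one] at h
  · intro u _ huw
    rw [h0 u u.2 w w.2 (fun h => huw (Subtype.ext h)), mul_zero]
  · simp

/-- A set of points of a subspace `H` that is cut out near one of its points by strict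
inequalities spans `H`. -/
theorem span_vec_image_eq {H : Submodule ℝ (MinkowskiSpace n)} {Q : Set (HyperbolicSpace n)}
    {W : Finset (MinkowskiSpace n)} (hQ : ∀ x ∈ Q, x.vec ∈ H)
    (hW : ∀ y : HyperbolicSpace n, y.vec ∈ H → (∀ w ∈ W, lorentz y.vec w ≤ 0) → y ∈ Q)
    {x : HyperbolicSpace n} (hx : x.vec ∈ H) (hxW : ∀ w ∈ W, lorentz x.vec w < 0) :
    Submodule.span ℝ (vec '' Q) = H := by
  apply le_antisymm
  · rw [Submodule.span_le]
    rintro _ ⟨y, hy, rfl⟩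
    exact hQ y hy
  · intro z hz
    obtain ⟨ε, hε, y, r, hr, hy, hyW⟩ := exists_perturbation x z W hxW
    have hyH : y.vec ∈ H := by
      have : r • y.vec ∈ H := hy ▸ H.add_mem hx (H.smul_mem _ hz)
      exact (H.smul_mem_iff hr.ne').mp this
    have hxs : x.vec ∈ Submodule.span ℝ (vec '' Q) :=
      Submodule.subset_span ⟨x, hW x hx fun w hw => (hxW w hw).le, rfl⟩
    have hys : y.vec ∈ Submodule.span ℝ (vec '' Q) :=
      Submodule.subset_span ⟨y, hW y hyH fun w hw => (hyW w hw).le, rfl⟩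
    have : z = ε⁻¹ • (r • y.vec - x.vec) := by
      rw [← hy, add_sub_cancel_left, smul_smul, inv_mul_cancel₀ hε.ne', one_smul]
    rw [this]
    exact Submodule.smul_mem _ _ (Submodule.sub_mem _ (Submodule.smul_mem _ _ hys) hxs)

/-! ### Systems of half-spaces and their interior points -/

/-- The points satisfying the constraints of `U`, those indexed by `S` with equality. -/
def face (U S : Finset (MinkowskiSpace n)) : Set (HyperbolicSpace n) :=
  {x | (∀ w ∈ U, lorentz x.vec w ≤ 0) ∧ ∀ w ∈ S, lorentz x.vec w = 0}

/-- The unit normals of the facets of a bounded polytope with interior points, in which any two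
facets form a non-obtuse angle, which is a right angle if the facets intersect. -/
structure RightAngledSystem (U : Finset (MinkowskiSpace n)) : Prop where
  unit : ∀ u ∈ U, lorentz u u = 1
  acute : ∀ u ∈ U, ∀ w ∈ U, u ≠ w → lorentz u w ≤ 0
  orth : ∀ u ∈ U, ∀ w ∈ U, u ≠ w → ∀ x ∈ face U ∅, lorentz x.vec u = 0 → lorentz x.vec w = 0 →
    lorentz u w = 0
  bounded : ∃ M : ℝ, ∀ x ∈ face U ∅, x.vec.1 ≤ M
  interior : ∃ p : HyperbolicSpace n, ∀ w ∈ U, lorentz p.vec w < 0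
  nonempty : U.Nonempty

/-- Take a subfamily of least cardinality. Dropping `w` from it admits a point violating `w` alone,
and the segment from `p` to that point crosses the wall of `w` where the other constraints are
strict. Taking `H = ⊤` yields the facets of the polytope, and `H = perp {w}` the ridges in a facet.
-/
theorem exists_irredundant (H : Submodule ℝ (MinkowskiSpace n)) (W : Finset (MinkowskiSpace n))
    (p : HyperbolicSpace n) (hp : p.vec ∈ H) (hpW : ∀ w ∈ W, lorentz p.vec w < 0) :
    ∃ W₀ ⊆ W, (∀ x : HyperbolicSpace n, x.vec ∈ H → (∀ w ∈ W₀, lorentz x.vec w ≤ 0) →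
        ∀ w ∈ W, lorentz x.vec w ≤ 0) ∧
      ∀ w ∈ W₀, ∃ z : HyperbolicSpace n, z.vec ∈ H ∧ lorentz z.vec w = 0 ∧
        ∀ w' ∈ W₀, w' ≠ w → lorentz z.vec w' < 0 := by
  classical
  obtain ⟨W₀, hW₀, hmin⟩ := Finset.exists_min_image (W.powerset.filter fun W₀ =>
    ∀ x : HyperbolicSpace n, x.vec ∈ H → (∀ w ∈ W₀, lorentz x.vec w ≤ 0) →
      ∀ w ∈ W, lorentz x.vec w ≤ 0) Finset.card
    ⟨W, by simp⟩
  rw [Finset.mem_filter, Finset.mem_powerset] at hW₀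
  refine ⟨W₀, hW₀.1, hW₀.2, fun w hw => ?_⟩
  have h1 : ¬ ∀ x : HyperbolicSpace n, x.vec ∈ H →
      (∀ w' ∈ W₀.erase w, lorentz x.vec w' ≤ 0) → ∀ w ∈ W, lorentz x.vec w ≤ 0 := by
    intro h
    have := hmin (W₀.erase w) (by
      rw [Finset.mem_filter, Finset.mem_powerset]
      exact ⟨(Finset.erase_subset _ _).trans hW₀.1, h⟩)
    exact absurd (Finset.card_erase_lt_of_mem hw) this.not_gt
  push Not at h1
  obtain ⟨x, hxH, hx, v, hv, hxv⟩ := h1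
  have hxw : 0 < lorentz x.vec w := by
    by_contra! h
    refine absurd (hW₀.2 x hxH (fun w' hw' => ?_) v hv) hxv.not_ge
    by_cases hww : w' = w
    · rwa [hww]
    · exact hx w' (Finset.mem_erase.mpr ⟨hww, hw'⟩)
  have hpw := hpW w (hW₀.1 hw)
  obtain ⟨z, r, hr, hz⟩ := exists_smul_vec_of_nonneg p x hxw (neg_pos.mpr hpw).le
  have hzv : ∀ v, r * lorentz z.vec v =
      lorentz x.vec w * lorentz p.vec v - lorentz p.vec w * lorentz x.vec v := by
    intro v
    rw [← lorentz_smul_left, ← hz, lorentz_add_left, lorentz_smul_left, lorentz_smul_left]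
    ring
  refine ⟨z, ?_, ?_, fun w' hw' hww => ?_⟩
  · exact (H.smul_mem_iff hr.ne').mp (hz ▸ H.add_mem (H.smul_mem _ hp) (H.smul_mem _ hxH))
  · have := hzv w
    have h0 : r * lorentz z.vec w = 0 := by rw [this]; ring
    exact (mul_eq_zero.mp h0).resolve_left hr.ne'
  · have h2 := hzv w'
    have h3 := hpW w' (hW₀.1 hw')
    have h4 := hx w' (Finset.mem_erase.mpr ⟨hww, hw'⟩)
    have h5 : r * lorentz z.vec w' < 0 := by
      rw [h2]
      nlinarith [mul_pos hxw (neg_pos.mpr h3),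
        mul_nonneg (neg_pos.mpr hpw).le (neg_nonneg.mpr h4)]
    exact (pos_iff_neg_of_mul_neg h5).mp hr

/-- Interior points satisfy the constraints strictly. -/
theorem lorentz_neg_of_mem_interior {P : Set (HyperbolicSpace n)} {u : MinkowskiSpace n}
    (hu : IsUnitNormal u) (hP : P ⊆ halfSpace u) {p : HyperbolicSpace n} (hp : p ∈ interior P) :
    lorentz p.vec u < 0 := by
  apply lt_of_le_of_ne (hP (interior_subset hp))
  intro h0
  obtain ⟨ε, hε, hball⟩ := Metric.mem_nhds_iff.mp (mem_interior_iff_mem_nhds.mp hp)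
  -- If `p` were on the wall, the geodesic leaving `p` in direction `u` would reach, at distance
  -- `s`, a point of the ball outside the half-space.
  set s := ε / 2 with hs
  have hs0 : 0 < s := by positivity
  have h0' : lorentz u p.vec = 0 := by rw [lorentz_comm, h0]
  have hself : lorentz (Real.cosh s • p.vec + Real.sinh s • u)
      (Real.cosh s • p.vec + Real.sinh s • u) = -1 := by
    simp only [lorentz_add_left, lorentz_smul_left, lorentz_add_right, lorentz_smul_right,
      p.lorentz_self, h0, h0', show lorentz u u = 1 from hu]
    nlinarith [Real.cosh_sq s]
  obtain ⟨y, r, hr, hy⟩ := exists_smul_vec (by rw [hself]; norm_num) p (by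
    rw [lorentz_add_left, lorentz_smul_left, lorentz_smul_left, p.lorentz_self, h0']
    linarith [Real.cosh_pos s] : lorentz (Real.cosh s • p.vec + Real.sinh s • u) p.vec < 0)
  have hr1 : r = 1 := by
    rw [hy, lorentz_smul_left, lorentz_smul_right, y.lorentz_self] at hself
    nlinarith
  rw [hr1, one_smul] at hy
  have hd : dist y p = s := by
    rw [dist_eq, ← hy, lorentz_add_left, lorentz_smul_left, lorentz_smul_left, p.lorentz_self,
      h0', mul_zero, add_zero, mul_neg_one, neg_neg, Real.arcosh_cosh hs0.le]
  have hyP : lorentz y.vec u ≤ 0 := hP (hball (by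
    rw [Metric.mem_ball, hd, hs]
    linarith))
  rw [← hy, lorentz_add_left, lorentz_smul_left, lorentz_smul_left, h0,
    show lorentz u u = 1 from hu] at hyP
  linarith [Real.sinh_pos_iff.mpr hs0]

/-- The base point of the hyperboloid model. -/
noncomputable def basePoint (n : ℕ) : HyperbolicSpace n where
  vec := (1, 0)
  lorentz_self := by simp [lorentz]
  time_pos := one_pos

theorem cosh_dist_basePoint (x : HyperbolicSpace n) :
    Real.cosh (dist x (basePoint n)) = x.vec.1 := by
  rw [cosh_dist]
  simp [lorentz, basePoint]

theorem exists_time_le {P : Set (HyperbolicSpace n)} (hP : Bornology.IsBounded P) :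
    ∃ M : ℝ, ∀ x ∈ P, x.vec.1 ≤ M := by
  obtain ⟨R, hR⟩ := hP.subset_closedBall (basePoint n)
  refine ⟨Real.cosh R, fun x hx => ?_⟩
  rw [← cosh_dist_basePoint, Real.cosh_le_cosh, abs_of_nonneg dist_nonneg]
  exact (Metric.mem_closedBall.mp (hR hx)).trans (le_abs_self R)

/-- Hyperbolic space of positive dimension is unbounded. -/
theorem exists_lt_time (hn : 1 ≤ n) (M : ℝ) : ∃ x : HyperbolicSpace n, M < x.vec.1 := by
  set s := |M| with hs
  refine ⟨⟨(√(1 + s ^ 2), EuclideanSpace.single ⟨0, hn⟩ s), ?_, ?_⟩, ?_⟩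
  · simp only [lorentz, real_inner_self_eq_norm_sq, PiLp.norm_single]
    rw [Real.mul_self_sqrt (by positivity), Real.norm_eq_abs, sq_abs]
    ring
  · positivity
  · refine (le_abs_self M).trans_lt (Real.lt_sqrt_of_sq_lt ?_)
    rw [hs]
    linarith

/-! ### From right-angled polytopes to systems of normals -/

theorem ne_smul_of_interior {u w : MinkowskiSpace n} {p : HyperbolicSpace n}
    (hu : lorentz u u = 1) (hw : lorentz w w = 1) (hpu : lorentz p.vec u < 0)
    (hpw : lorentz p.vec w < 0) (huw : u ≠ w) (t : ℝ) : t • u ≠ w := by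
  intro h
  have h1 : t * t = 1 := by
    rw [← h, lorentz_smul_left, lorentz_smul_right, hu] at hw
    linarith
  rcases mul_self_eq_one_iff.mp h1 with h2 | h2
  · exact huw (by rw [← h, h2, one_smul])
  · rw [← h, h2, lorentz_smul_right] at hpw
    linarith

theorem isFacet_of_irredundant {W : Finset (MinkowskiSpace n)} {u : MinkowskiSpace n}
    (huW : u ∈ W) (hu : lorentz u u = 1) {z : HyperbolicSpace n} (hz : lorentz z.vec u = 0)
    (hzW : ∀ w ∈ W, w ≠ u → lorentz z.vec w < 0) :
    IsFacet (face W ∅) (face W ∅ ∩ hyperplane u) := by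
  classical
  have hspan : Submodule.span ℝ (vec '' (face W ∅ ∩ hyperplane u)) = perp {u} := by
    refine span_vec_image_eq (W := W.erase u) (x := z) ?_ ?_ ?_ ?_
    · rintro x ⟨_, hx⟩ w hw
      rw [Finset.mem_singleton.mp hw]
      exact hx
    · intro y hy hyW
      have hyu : lorentz y.vec u = 0 := hy u (Finset.mem_singleton_self u)
      refine ⟨⟨fun w hw => ?_, by simp⟩, hyu⟩
      by_cases h : w = u
      · rw [h, hyu]
      · exact hyW w (Finset.mem_erase.mpr ⟨h, hw⟩)
    · intro w hw
      rwa [Finset.mem_singleton.mp hw]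
    · intro w hw
      rw [Finset.mem_erase] at hw
      exact hzW w hw.2 hw.1
  have hfin := finrank_perp (S := {u}) (linearIndependent_of_orthonormal (by simpa using hu)
    (by simp))
  rw [Finset.card_singleton] at hfin
  have hpos : 0 < Module.finrank ℝ (perp {u}) := by
    rw [Module.finrank_pos_iff_exists_ne_zero]
    exact ⟨⟨z.vec, by simpa [mem_perp] using hz⟩, fun h => vec_ne_zero z (congrArg Subtype.val h)⟩
  have hzF : z ∈ face W ∅ := by
    refine ⟨fun w hw => ?_, by simp⟩
    by_cases h : w = u
    · rw [h, hz]
    · exact (hzW w hw h).le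
  refine ⟨n - 1, by omega, ⟨⟨z, hzF, hz⟩, Or.inr ⟨u, hu, fun x hx => hx.1 u huW, rfl⟩⟩, ?_⟩
  rw [hspan]
  omega

/-- The normalized sum of `u` and `w` is a supporting normal: two nonpositive numbers add up to zero
only if both vanish. It can be normalized because `u + w` is nonzero and orthogonal to `z`. As `z`
satisfies the remaining constraints strictly, the intersection spans all of `perp {u, w}`. -/
theorem isRidge_of_cut {P : Set (HyperbolicSpace n)} {u w : MinkowskiSpace n}
    (hli : ∀ t : ℝ, t • u ≠ w) (hu : u ≠ 0) (hPu : P ⊆ halfSpace u) (hPw : P ⊆ halfSpace w)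
    {W : Finset (MinkowskiSpace n)} {z : HyperbolicSpace n}
    (hzu : lorentz z.vec u = 0) (hzw : lorentz z.vec w = 0)
    (hzW : ∀ v ∈ W, lorentz z.vec v < 0)
    (hW : ∀ y : HyperbolicSpace n, lorentz y.vec u = 0 → lorentz y.vec w = 0 →
      (∀ v ∈ W, lorentz y.vec v ≤ 0) → y ∈ P) :
    IsRidge P (P ∩ hyperplane u ∩ (P ∩ hyperplane w)) := by
  classical
  have huw : u ≠ w := fun h => hli 1 (by rwa [one_smul])
  have hspan : Submodule.span ℝ (vec '' (P ∩ hyperplane u ∩ (P ∩ hyperplane w))) =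
      perp {u, w} := by
    refine span_vec_image_eq (W := W) (x := z) ?_ ?_ ?_ hzW
    · rintro x ⟨⟨_, hx⟩, _, hx'⟩
      simp only [mem_perp, Finset.mem_insert, Finset.mem_singleton, forall_eq_or_imp, forall_eq]
      exact ⟨hx, hx'⟩
    · intro y hy hyW
      simp only [mem_perp, Finset.mem_insert, Finset.mem_singleton, forall_eq_or_imp,
        forall_eq] at hy
      have := hW y hy.1 hy.2 hyW
      exact ⟨⟨this, hy.1⟩, this, hy.2⟩
    · simp only [mem_perp, Finset.mem_insert, Finset.mem_singleton, forall_eq_or_imp, forall_eq]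
      exact ⟨hzu, hzw⟩
  have hind : LinearIndependent ℝ (fun x : ({u, w} : Finset (MinkowskiSpace n)) =>
      (x : MinkowskiSpace n)) := by
    have := (LinearIndependent.pair_iff' hu).mpr hli
    have h2 := (LinearIndepOn.pair_iff (R := ℝ) (id : MinkowskiSpace n → MinkowskiSpace n)
      huw).mpr ?_
    · rw [← Finset.coe_pair] at h2
      exact h2
    · exact LinearIndependent.pair_iff.mp this
  have hfin := finrank_perp hind
  rw [Finset.card_pair huw] at hfin
  have hpos : 0 < Module.finrank ℝ (perp {u, w}) := by
    rw [Module.finrank_pos_iff_exists_ne_zero]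
    exact ⟨⟨z.vec, by simpa [mem_perp] using ⟨hzu, hzw⟩⟩,
      fun h => vec_ne_zero z (congrArg Subtype.val h)⟩
  have hzP := hW z hzu hzw fun v hv => (hzW v hv).le
  have hne : u + w ≠ 0 := fun h => hli (-1) (by
    rw [neg_one_smul, neg_eq_iff_add_eq_zero, h])
  have hnorm : 0 < lorentz (u + w) (u + w) := lorentz_self_pos z
    (by rw [lorentz_add_left, lorentz_comm, hzu, lorentz_comm, hzw, add_zero]) hne
  set r := √(lorentz (u + w) (u + w)) with hr
  have hr0 : 0 < r := Real.sqrt_pos.mpr hnorm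
  have hrr : r * r = lorentz (u + w) (u + w) := Real.mul_self_sqrt hnorm.le
  have hv : ∀ x : HyperbolicSpace n, lorentz x.vec (r⁻¹ • (u + w)) =
      r⁻¹ * (lorentz x.vec u + lorentz x.vec w) := fun x => by
    rw [lorentz_smul_right, lorentz_add_right]
  refine ⟨n - 2, by omega, ⟨⟨z, ⟨hzP, hzu⟩, hzP, hzw⟩, Or.inr ⟨r⁻¹ • (u + w), ?_, ?_, ?_⟩⟩, ?_⟩
  · rw [IsUnitNormal, lorentz_smul_left, lorentz_smul_right, ← hrr]
    field_simp
  · intro x hx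
    rw [halfSpace, Set.mem_ofPred_eq, hv]
    exact mul_nonpos_of_nonneg_of_nonpos (inv_pos.mpr hr0).le
      (add_nonpos (hPu hx) (hPw hx))
  · ext x
    simp only [Set.mem_inter_iff, hyperplane, Set.mem_ofPred_eq, hv]
    constructor
    · rintro ⟨⟨hx, h1⟩, _, h2⟩
      exact ⟨hx, by rw [h1, h2, add_zero, mul_zero]⟩
    · rintro ⟨hx, h⟩
      have h1 : lorentz x.vec u ≤ 0 := hPu hx
      have h2 : lorentz x.vec w ≤ 0 := hPw hx
      have h3 := (mul_eq_zero.mp h).resolve_left (inv_pos.mpr hr0).ne'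
      exact ⟨⟨hx, by linarith⟩, hx, by linarith⟩
  rw [hspan]
  omega

theorem face_empty_subset_halfSpace {U : Finset (MinkowskiSpace n)} {u : MinkowskiSpace n}
    (hu : u ∈ U) : face U ∅ ⊆ halfSpace u := fun _ hx => hx.1 u hu

/-- Facets meeting in a ridge of a right-angled polytope have orthogonal normals. -/
theorem IsRightAngled.lorentz_eq_zero {U : Finset (MinkowskiSpace n)}
    (hright : IsRightAngled (face U ∅)) (hunit : ∀ u ∈ U, lorentz u u = 1)
    (hfacet : ∀ u ∈ U, IsFacet (face U ∅) (face U ∅ ∩ hyperplane u))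
    {p : HyperbolicSpace n} (hp : ∀ u ∈ U, lorentz p.vec u < 0)
    {u w : MinkowskiSpace n} (hu : u ∈ U) (hw : w ∈ U) (huw : u ≠ w)
    {W : Finset (MinkowskiSpace n)} {z : HyperbolicSpace n}
    (hzu : lorentz z.vec u = 0) (hzw : lorentz z.vec w = 0)
    (hzW : ∀ v ∈ W, lorentz z.vec v < 0)
    (hW : ∀ y : HyperbolicSpace n, lorentz y.vec u = 0 → lorentz y.vec w = 0 →
      (∀ v ∈ W, lorentz y.vec v ≤ 0) → y ∈ face U ∅) : lorentz u w = 0 := by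
  have h := hright _ _ (hfacet u hu) (hfacet w hw)
    (isRidge_of_cut (ne_smul_of_interior (hunit u hu) (hunit w hw) (hp u hu) (hp w hw) huw)
      (fun h => by simpa [h] using hunit u hu) (face_empty_subset_halfSpace hu)
      (face_empty_subset_halfSpace hw) hzu hzw hzW hW) u w
    ⟨hunit u hu, face_empty_subset_halfSpace hu, rfl⟩
    ⟨hunit w hw, face_empty_subset_halfSpace hw, rfl⟩
  rw [dihedralAngle, Real.arccos_eq_pi_div_two] at h
  linarith

/-- Within the facet of `w`, keep an irredundant family `I` of constraints; each member meets `w` in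
a ridge and so is orthogonal to `w`. If `u ∉ I`, project a point `z` with only the constraint `u`
tight onto the hyperplane of `w`. This does not affect the signs of the constraints in `I`, so the
projection lies in the polytope, and its constraint at `u` is the claim. -/
theorem acute_of_isRightAngled {U : Finset (MinkowskiSpace n)}
    (hright : IsRightAngled (face U ∅)) (hunit : ∀ u ∈ U, lorentz u u = 1)
    {p : HyperbolicSpace n} (hp : ∀ u ∈ U, lorentz p.vec u < 0)
    (hirr : ∀ u ∈ U, ∃ z : HyperbolicSpace n, lorentz z.vec u = 0 ∧
      ∀ w ∈ U, w ≠ u → lorentz z.vec w < 0)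
    {u w : MinkowskiSpace n} (hu : u ∈ U) (hw : w ∈ U) (huw : u ≠ w) : lorentz u w ≤ 0 := by
  classical
  have hfacet : ∀ u ∈ U, IsFacet (face U ∅) (face U ∅ ∩ hyperplane u) := by
    intro u hu
    obtain ⟨z, hz, hzW⟩ := hirr u hu
    exact isFacet_of_irredundant hu (hunit u hu) hz hzW
  obtain ⟨q, hq, hqW⟩ := hirr w hw
  have hmem : ∀ x : HyperbolicSpace n, x.vec ∈ perp {w} ↔ lorentz x.vec w = 0 := by
    simp [mem_perp]
  obtain ⟨I, hIU, hI, hIirr⟩ := exists_irredundant (perp {w}) (U.erase w) q ((hmem q).mpr hq)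
    (fun v hv => hqW v (Finset.mem_erase.mp hv).2 (Finset.mem_erase.mp hv).1)
  have hI' : ∀ y : HyperbolicSpace n, lorentz y.vec w = 0 → (∀ v ∈ I, lorentz y.vec v ≤ 0) →
      y ∈ face U ∅ := by
    intro y hy hyI
    refine ⟨fun v hv => ?_, by simp⟩
    by_cases h : v = w
    · rw [h, hy]
    · exact hI y ((hmem y).mpr hy) hyI v (Finset.mem_erase.mpr ⟨h, hv⟩)
  by_cases huI : u ∈ I
  · obtain ⟨z, hzw, hzu, hzI⟩ := hIirr u huI
    refine (hright.lorentz_eq_zero hunit hfacet hp hu hw huw (W := I.erase u) hzu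
      ((hmem z).mp hzw) (fun v hv => ?_) (fun y hyu hyw hy => hI' y hyw fun v hv => ?_)).le
    · exact hzI v (Finset.mem_erase.mp hv).2 (Finset.mem_erase.mp hv).1
    · by_cases h : v = u
      · rw [h, hyu]
      · exact hy v (Finset.mem_erase.mpr ⟨h, hv⟩)
  · obtain ⟨z, hzu, hzW⟩ := hirr u hu
    obtain ⟨y, r, hr, hy⟩ := exists_smul_vec_proj z (hunit w hw)
    have hyv : ∀ v, r * lorentz y.vec v =
        lorentz z.vec v - lorentz z.vec w * lorentz w v := fun v => by
      rw [← lorentz_smul_left, ← hy, lorentz_sub_left, lorentz_smul_left]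
    have hyw : lorentz y.vec w = 0 := by
      have := hyv w
      rw [hunit w hw, mul_one, sub_self] at this
      exact (mul_eq_zero.mp this).resolve_left hr.ne'
    have hyP : y ∈ face U ∅ := by
      refine hI' y hyw fun v hv => ?_
      have hvU := Finset.mem_erase.mp (hIU hv)
      have hzv := hzW v hvU.2 (fun h => huI (h ▸ hv))
      have hwv : lorentz w v = 0 := by
        obtain ⟨x, hxw, hxv, hxI⟩ := hIirr v hv
        rw [lorentz_comm]
        refine hright.lorentz_eq_zero hunit hfacet hp hvU.2 hw hvU.1 (W := I.erase v) hxv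
          ((hmem x).mp hxw) (fun v' hv' => ?_) (fun y hyu hyw hy => hI' y hyw fun v' hv' => ?_)
        · exact hxI v' (Finset.mem_erase.mp hv').2 (Finset.mem_erase.mp hv').1
        · by_cases h : v' = v
          · rw [h, hyu]
          · exact hy v' (Finset.mem_erase.mpr ⟨h, hv'⟩)
      have := hyv v
      rw [hwv, mul_zero, sub_zero] at this
      nlinarith
    have h1 := hyv u
    have h2 := hyP.1 u hu
    have h3 := hzW w hw huw.symm
    rw [hzu, lorentz_comm w u] at h1
    nlinarith [mul_nonneg hr.le (neg_nonneg.mpr h2)]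

/-- The point `x` forces `u` and `w` to span a positive definite plane. Projecting an interior point
`p` orthogonally away from this plane adds positive multiples of `u` and `w`, which by acuteness
keeps all other constraints strict. The two facets therefore share a ridge, where the angle is
right. -/
theorem lorentz_eq_zero_of_isRightAngled {U : Finset (MinkowskiSpace n)}
    (hright : IsRightAngled (face U ∅)) (hunit : ∀ u ∈ U, lorentz u u = 1)
    {p : HyperbolicSpace n} (hp : ∀ u ∈ U, lorentz p.vec u < 0)
    (hirr : ∀ u ∈ U, ∃ z : HyperbolicSpace n, lorentz z.vec u = 0 ∧
      ∀ w ∈ U, w ≠ u → lorentz z.vec w < 0)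
    {u w : MinkowskiSpace n} (hu : u ∈ U) (hw : w ∈ U) (huw : u ≠ w) {x : HyperbolicSpace n}
    (hxu : lorentz x.vec u = 0) (hxw : lorentz x.vec w = 0) : lorentz u w = 0 := by
  classical
  have hacute : ∀ u ∈ U, ∀ w ∈ U, u ≠ w → lorentz u w ≤ 0 := fun u hu w hw huw =>
    acute_of_isRightAngled hright hunit hp hirr hu hw huw
  have hfacet : ∀ u ∈ U, IsFacet (face U ∅) (face U ∅ ∩ hyperplane u) := by
    intro u hu
    obtain ⟨z, hz, hzW⟩ := hirr u hu
    exact isFacet_of_irredundant hu (hunit u hu) hz hzW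
  have hc0 := hacute u hu w hw huw
  have hne : u + w ≠ 0 := fun h =>
    ne_smul_of_interior (hunit u hu) (hunit w hw) (hp u hu) (hp w hw) huw (-1) (by
      rw [neg_one_smul, neg_eq_iff_add_eq_zero, h])
  have hnorm : 0 < lorentz (u + w) (u + w) := lorentz_self_pos x
    (by rw [lorentz_add_left, lorentz_comm, hxu, lorentz_comm, hxw, add_zero]) hne
  rw [lorentz_add_left, lorentz_add_right, lorentz_add_right, hunit u hu, hunit w hw,
    lorentz_comm w u] at hnorm
  set c := -lorentz u w with hc
  have hd : 0 < 1 - c ^ 2 := by nlinarith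
  set a := -lorentz p.vec u with ha
  set b := -lorentz p.vec w with hb
  have ha0 : 0 < a := by linarith [hp u hu]
  have hb0 : 0 < b := by linarith [hp w hw]
  -- Solution of the Gram system for `v` to be orthogonal to `u` and `w`, with the determinant `1 -
  -- c ^ 2` cleared.
  set α := a + c * b with hα
  set β := b + c * a with hβ
  have hα0 : 0 < α := by nlinarith
  have hβ0 : 0 < β := by nlinarith
  set v := (1 - c ^ 2) • p.vec + (α • u + β • w) with hv
  have hlor : ∀ y, lorentz v y =
      (1 - c ^ 2) * lorentz p.vec y + (α * lorentz u y + β * lorentz w y) := fun y => by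
    rw [hv, lorentz_add_left, lorentz_add_left, lorentz_smul_left, lorentz_smul_left,
      lorentz_smul_left]
  have hvu : lorentz v u = 0 := by
    rw [hlor, hunit u hu, lorentz_comm w u, ← neg_neg (lorentz u w), ← hc,
      ← neg_neg (lorentz p.vec u), ← ha]
    ring
  have hvw : lorentz v w = 0 := by
    rw [hlor, hunit w hw, ← neg_neg (lorentz u w), ← hc, ← neg_neg (lorentz p.vec w), ← hb]
    ring
  have hvp : lorentz v p.vec < 0 := by
    rw [hlor, p.lorentz_self, lorentz_comm u, lorentz_comm w, ← neg_neg (lorentz p.vec u), ← ha,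
      ← neg_neg (lorentz p.vec w), ← hb]
    nlinarith [mul_pos hα0 ha0, mul_pos hβ0 hb0]
  have hvv : lorentz v v < 0 := by
    have h1 : lorentz v v = (1 - c ^ 2) * lorentz v p.vec := by
      rw [hlor, lorentz_comm u v, lorentz_comm w v, hvu, hvw, lorentz_comm]
      ring
    rw [h1]
    exact mul_neg_of_pos_of_neg hd hvp
  obtain ⟨z, r, hr, hz⟩ := exists_smul_vec hvv p hvp
  have hzv : ∀ y, r * lorentz z.vec y = lorentz v y := fun y => by
    rw [hz, lorentz_smul_left]
  refine hright.lorentz_eq_zero hunit hfacet hp hu hw huw (W := (U.erase u).erase w) (z := z)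
    ?_ ?_ ?_ ?_
  · have := hzv u
    rw [hvu] at this
    exact (mul_eq_zero.mp this).resolve_left hr.ne'
  · have := hzv w
    rw [hvw] at this
    exact (mul_eq_zero.mp this).resolve_left hr.ne'
  · intro y hy
    simp only [Finset.mem_erase] at hy
    have h1 := hzv y
    have h2 := hp y hy.2.2
    have h3 := hacute u hu y hy.2.2 (Ne.symm hy.2.1)
    have h4 := hacute w hw y hy.2.2 (Ne.symm hy.1)
    rw [hlor] at h1
    have h5 : r * lorentz z.vec y < 0 := by
      rw [h1]
      nlinarith [mul_pos hd (neg_pos.mpr h2), mul_nonneg hα0.le (neg_nonneg.mpr h3),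
        mul_nonneg hβ0.le (neg_nonneg.mpr h4)]
    exact (pos_iff_neg_of_mul_neg h5).mp hr
  · intro y hyu hyw hy
    refine ⟨fun t ht => ?_, by simp⟩
    by_cases h1 : t = u
    · rw [h1, hyu]
    by_cases h2 : t = w
    · rw [h2, hyw]
    exact hy t (by simp [h1, h2, ht])

theorem exists_rightAngledSystem (hn : 1 ≤ n) {P : Set (HyperbolicSpace n)}
    (hP : IsConvexPolytope P) (hright : IsRightAngled P) :
    ∃ U : Finset (MinkowskiSpace n), RightAngledSystem U ∧ P = face U ∅ := by
  obtain ⟨⟨V, hV, hPV⟩, hbdd, p, hp⟩ := hP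
  have hpV : ∀ v ∈ V, lorentz p.vec v < 0 := fun v hv =>
    lorentz_neg_of_mem_interior (hV v hv) (hPV ▸ Set.biInter_subset_of_mem hv) hp
  obtain ⟨U, hUV, hU, hirr⟩ := exists_irredundant ⊤ V p trivial hpV
  have hPU : P = face U ∅ := by
    ext x
    simp only [hPV, Set.mem_iInter, halfSpace, Set.mem_ofPred_eq, face]
    exact ⟨fun h => ⟨fun w hw => h w (hUV hw), by simp⟩, fun h => hU x trivial h.1⟩
  have hunit : ∀ u ∈ U, lorentz u u = 1 := fun u hu => hV u (hUV hu)
  have hpU : ∀ u ∈ U, lorentz p.vec u < 0 := fun u hu => hpV u (hUV hu)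
  have hirr' : ∀ u ∈ U, ∃ z : HyperbolicSpace n, lorentz z.vec u = 0 ∧
      ∀ w ∈ U, w ≠ u → lorentz z.vec w < 0 := fun u hu => by
    obtain ⟨z, -, h⟩ := hirr u hu
    exact ⟨z, h⟩
  obtain ⟨M, hM⟩ := exists_time_le hbdd
  subst hPU
  refine ⟨U, ⟨hunit, fun u hu w hw huw => acute_of_isRightAngled hright hunit hpU hirr' hu hw huw,
    fun u hu w hw huw x _ hxu hxw =>
      lorentz_eq_zero_of_isRightAngled hright hunit hpU hirr' hu hw huw hxu hxw,
    ⟨M, hM⟩, ⟨p, hpU⟩, ?_⟩, rfl⟩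
  rw [Finset.nonempty_iff_ne_empty]
  rintro rfl
  -- Without constraints the polytope would be the whole space, which is unbounded.
  obtain ⟨x, hx⟩ := exists_lt_time hn M
  exact absurd (hM x ⟨by simp, by simp⟩) hx.not_ge

/-! ### Faces and their links -/

theorem face_anti {U S T : Finset (MinkowskiSpace n)} (h : S ⊆ T) : face U T ⊆ face U S :=
  fun _ hx => ⟨hx.1, fun w hw => hx.2 w (h hw)⟩

theorem mem_face_insert [DecidableEq (MinkowskiSpace n)] {U S : Finset (MinkowskiSpace n)}
    {u : MinkowskiSpace n} {x : HyperbolicSpace n} :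
    x ∈ face U (insert u S) ↔ x ∈ face U S ∧ lorentz x.vec u = 0 := by
  simp only [face, Set.mem_ofPred_eq, Finset.mem_insert, forall_eq_or_imp]
  tauto

open Classical in
/-- The normals, among those in `U` and not in `S`, of the facets of `face U S`. -/
noncomputable def link (U S : Finset (MinkowskiSpace n)) : Finset (MinkowskiSpace n) :=
  U.filter fun u => u ∉ S ∧ (face U (insert u S)).Nonempty

theorem mem_link [DecidableEq (MinkowskiSpace n)] {U S : Finset (MinkowskiSpace n)}
    {u : MinkowskiSpace n} :
    u ∈ link U S ↔ u ∈ U ∧ u ∉ S ∧ (face U (insert u S)).Nonempty := by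
  unfold link
  rw [@Finset.mem_filter]
  convert Iff.rfl

theorem link_insert_subset [DecidableEq (MinkowskiSpace n)] {U S : Finset (MinkowskiSpace n)}
    {u : MinkowskiSpace n} : link U (insert u S) ⊆ link U S := by
  intro w hw
  rw [mem_link] at hw ⊢
  exact ⟨hw.1, fun h => hw.2.1 (Finset.mem_insert_of_mem h),
    hw.2.2.mono (face_anti (Finset.insert_subset_insert _ (Finset.subset_insert _ _)))⟩

namespace RightAngledSystem

variable {U S : Finset (MinkowskiSpace n)}

theorem orthogonal (hU : RightAngledSystem U) (hS : S ⊆ U) (hne : (face U S).Nonempty) :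
    ∀ u ∈ S, ∀ w ∈ S, u ≠ w → lorentz u w = 0 := by
  intro u hu w hw huw
  obtain ⟨x, hx⟩ := hne
  exact hU.orth u (hS hu) w (hS hw) huw x (face_anti (Finset.empty_subset _) hx) (hx.2 u hu)
    (hx.2 w hw)

theorem finrank_perp_add_card (hU : RightAngledSystem U) (hS : S ⊆ U)
    (hne : (face U S).Nonempty) : Module.finrank ℝ (perp S) + S.card = n + 1 :=
  finrank_perp (linearIndependent_of_orthonormal (fun u hu => hU.unit u (hS hu))
    (hU.orthogonal hS hne))

/-- A relative interior point of a face. -/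
theorem exists_relint (hU : RightAngledSystem U) (hS : S ⊆ U) (hne : (face U S).Nonempty) :
    ∃ p ∈ face U S, ∀ w ∈ U, w ∉ S → lorentz p.vec w < 0 := by
  classical
  obtain ⟨x, hx⟩ := hne
  set T := U.filter fun w => lorentz x.vec w = 0 ∧ w ∉ S with hT
  have hTU : ∀ w ∈ T, w ∈ U ∧ lorentz x.vec w = 0 ∧ w ∉ S := fun w hw => by
    simpa [hT] using hw
  -- The constraints tight at `x` are pairwise orthogonal, so this move makes each member of `T`
  -- strict and keeps those of `S` tight.
  obtain ⟨ε, hε, y, r, hr, hy, hyW⟩ := exists_perturbation x (-∑ u ∈ T, u)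
    (U.filter fun w => lorentz x.vec w < 0) (fun w hw => (Finset.mem_filter.mp hw).2)
  have hyv : ∀ v, r * lorentz y.vec v = lorentz x.vec v - ε * ∑ u ∈ T, lorentz u v := fun v => by
    rw [← lorentz_smul_left, ← hy, lorentz_add_left, lorentz_smul_left, lorentz_neg_left,
      lorentz_sum_left]
    ring
  have hzero : ∀ u ∈ U, ∀ w ∈ U, u ≠ w → lorentz x.vec u = 0 → lorentz x.vec w = 0 →
      lorentz u w = 0 := fun u hu w hw huw =>
    hU.orth u hu w hw huw x (face_anti (Finset.empty_subset _) hx)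
  have hyS : ∀ w ∈ S, lorentz y.vec w = 0 := fun w hw => by
    have := hyv w
    rw [hx.2 w hw, Finset.sum_eq_zero (fun u hu => hzero u (hTU u hu).1 w (hS hw)
      (fun h => (hTU u hu).2.2 (h ▸ hw)) (hTU u hu).2.1 (hx.2 w hw)), mul_zero, sub_zero] at this
    exact (mul_eq_zero.mp this).resolve_left hr.ne'
  have hyneg : ∀ w ∈ U, w ∉ S → lorentz y.vec w < 0 := fun w hw hwS => by
    by_cases h : lorentz x.vec w = 0
    · have hwT : w ∈ T := by simp [hT, hw, h, hwS]
      have := hyv w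
      rw [Finset.sum_eq_single w (fun u hu huw => hzero u (hTU u hu).1 w hw huw (hTU u hu).2.1 h)
        (fun h => absurd hwT h), h, hU.unit w hw] at this
      nlinarith
    · exact hyW w (by simp [hw, lt_of_le_of_ne (hx.1 w hw) h])
  refine ⟨y, ⟨fun w hw => ?_, hyS⟩, hyneg⟩
  by_cases h : w ∈ S
  · rw [hyS w h]
  · exact (hyneg w hw h).le

theorem span_face (hU : RightAngledSystem U) (hS : S ⊆ U) (hne : (face U S).Nonempty) :
    Submodule.span ℝ (vec '' face U S) = perp S := by
  classical
  obtain ⟨p, hp, hpW⟩ := hU.exists_relint hS hne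
  refine span_vec_image_eq (W := U \ S) (x := p) (fun x hx => hx.2) (fun y hy hyW => ⟨?_, hy⟩)
    hp.2 (fun w hw => hpW w (Finset.mem_sdiff.mp hw).1 (Finset.mem_sdiff.mp hw).2)
  intro w hw
  by_cases h : w ∈ S
  · rw [hy w h]
  · exact hyW w (Finset.mem_sdiff.mpr ⟨hw, h⟩)

/-- The cone cut out by the constraints consists of multiples of points of the polytope. -/
theorem exists_smul_of_mem_cone (hU : RightAngledSystem U) {v : MinkowskiSpace n} (hv : v ≠ 0)
    (hvU : ∀ w ∈ U, lorentz v w ≤ 0) :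
    ∃ x ∈ face U ∅, ∃ r : ℝ, 0 < r ∧ v = r • x.vec := by
  obtain ⟨p, hp⟩ := hU.interior
  obtain ⟨M, hM⟩ := hU.bounded
  obtain ⟨u, hu⟩ := hU.nonempty
  set q : unitInterval → MinkowskiSpace n := fun t => (1 - (t : ℝ)) • p.vec + (t : ℝ) • v with hq
  have hqc : Continuous q := by fun_prop
  have hqU : ∀ t, ∀ w ∈ U, lorentz (q t) w ≤ 0 := fun t w hw => by
    rw [hq, lorentz_add_left, lorentz_smul_left, lorentz_smul_left]
    nlinarith [mul_nonneg (unitInterval.one_minus_nonneg t) (neg_pos.mpr (hp w hw)).le,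
      mul_nonneg (unitInterval.nonneg t) (neg_nonneg.mpr (hvU w hw))]
  have hq0 : ∀ t, q t ≠ 0 := fun t h => by
    by_cases ht : (t : ℝ) = 1
    · apply hv
      simpa [hq, ht] using h
    · have h1 : lorentz (q t) u = 0 := by rw [h, lorentz_zero_left]
      rw [hq, lorentz_add_left, lorentz_smul_left, lorentz_smul_left] at h1
      have h2 : 0 < 1 - (t : ℝ) := by
        have := unitInterval.one_minus_nonneg t
        exact lt_of_le_of_ne this fun h => ht (by linarith)
      nlinarith [mul_pos h2 (neg_pos.mpr (hp u hu)),
        mul_nonneg (unitInterval.nonneg t) (neg_nonneg.mpr (hvU u hu))]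
  have hpoint : ∀ t, 0 < (q t).1 → lorentz (q t) (q t) < 0 →
      ∃ x ∈ face U ∅, ∃ r : ℝ, 0 < r ∧ q t = r • x.vec := by
    intro t h1 h2
    obtain ⟨x, r, hr, hx⟩ := exists_smul_vec h2 (basePoint n) (by
      simpa [lorentz, basePoint] using h1)
    refine ⟨x, ⟨fun w hw => ?_, by simp⟩, r, hr, hx⟩
    have := hqU t w hw
    rw [hx, lorentz_smul_left] at this
    exact nonpos_of_mul_nonpos_right this hr
  set G : Set unitInterval := {t | 0 < (q t).1 ∧ lorentz (q t) (q t) < 0} with hG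
  -- Boundedness keeps the cone uniformly away from the light cone, so the open condition of being
  -- future time-like is also closed along the segment from `p` to `v`; connectedness then carries
  -- it to `v`.
  have hGeq : G = {t | 0 ≤ (q t).1 ∧ (q t).1 ^ 2 ≤ -(M ^ 2 * lorentz (q t) (q t))} := by
    ext t
    constructor
    · rintro ⟨h1, h2⟩
      refine ⟨h1.le, ?_⟩
      obtain ⟨x, hx, r, hr, hqx⟩ := hpoint t h1 h2
      rw [hqx, lorentz_smul_left, lorentz_smul_right, x.lorentz_self, Prod.smul_fst, smul_eq_mul]
      have h3 : x.vec.1 ^ 2 ≤ M ^ 2 := pow_le_pow_left₀ x.time_pos.le (hM x hx) 2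
      nlinarith [mul_le_mul_of_nonneg_left h3 (sq_nonneg r)]
    · rintro ⟨h1, h2⟩
      have h3 : lorentz (q t) (q t) < 0 := by
        by_contra! h4
        have h5 : (q t).1 = 0 := by
          nlinarith [mul_nonneg (sq_nonneg M) h4, sq_nonneg (q t).1]
        have h6 : ‖(q t).2‖ ^ 2 ≤ 0 := by
          have h7 := h2
          by_cases hM0 : M ^ 2 = 0
          · exfalso
            have h8 := hM p ⟨fun w hw => (hp w hw).le, by simp⟩
            have h9 := p.time_pos
            nlinarith
          · have h8 : 0 < M ^ 2 := lt_of_le_of_ne (sq_nonneg M) (Ne.symm hM0)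
            simp only [lorentz, real_inner_self_eq_norm_sq, h5] at h7
            nlinarith
        have h7 : (q t).2 = 0 := by
          rw [← norm_eq_zero]
          nlinarith [sq_nonneg ‖(q t).2‖]
        exact hq0 t (Prod.ext h5 h7)
      refine ⟨lt_of_le_of_ne h1 fun h => ?_, h3⟩
      simp only [lorentz, real_inner_self_eq_norm_sq, ← h] at h3
      nlinarith [sq_nonneg ‖(q t).2‖]
  have hlor : Continuous fun t => lorentz (q t) (q t) := by
    unfold lorentz
    fun_prop
  have hopen : IsOpen G :=
    (isOpen_lt continuous_const (continuous_fst.comp hqc)).inter (isOpen_lt hlor continuous_const)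
  have hclosed : IsClosed G := by
    rw [hGeq]
    exact (isClosed_le continuous_const (continuous_fst.comp hqc)).inter
      (isClosed_le ((continuous_fst.comp hqc).pow 2) (continuous_const.mul hlor).neg)
  have huniv : G = Set.univ := IsClopen.eq_univ ⟨hclosed, hopen⟩
    ⟨0, by simp [hG, hq, p.time_pos, p.lorentz_self]⟩
  have h1 : (1 : unitInterval) ∈ G := huniv ▸ Set.mem_univ _
  have h2 : q 1 = v := by simp [hq]
  rw [← h2]
  exact hpoint 1 h1.1 h1.2

/-- A supporting hyperplane through a relative interior point of a face contains the face. -/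
theorem lorentz_eq_zero_of_supporting {p : HyperbolicSpace n} (hp : p ∈ face U S)
    (hpW : ∀ w ∈ U, w ∉ S → lorentz p.vec w < 0) {v : MinkowskiSpace n}
    (hv : ∀ y ∈ face U ∅, lorentz y.vec v ≤ 0) (hpv : lorentz p.vec v = 0)
    {z : MinkowskiSpace n} (hz : z ∈ perp S) : lorentz z v = 0 := by
  classical
  -- A small move from `p` along `perp S` stays in the polytope; both `z` and `-z` are allowed.
  have key : ∀ z ∈ perp S, lorentz z v ≤ 0 := by
    intro z hz
    obtain ⟨ε, hε, y, r, hr, hy, hyW⟩ := exists_perturbation p z (U \ S)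
      (fun w hw => hpW w (Finset.mem_sdiff.mp hw).1 (Finset.mem_sdiff.mp hw).2)
    have hyP : y ∈ face U ∅ := by
      refine ⟨fun w hw => ?_, by simp⟩
      by_cases h : w ∈ S
      · have h1 : r * lorentz y.vec w = 0 := by
          rw [← lorentz_smul_left, ← hy, lorentz_add_left, lorentz_smul_left, hp.2 w h, hz w h]
          ring
        exact ((mul_eq_zero.mp h1).resolve_left hr.ne').le
      · exact (hyW w (Finset.mem_sdiff.mpr ⟨hw, h⟩)).le
    have h1 : r * lorentz y.vec v = ε * lorentz z v := by
      rw [← lorentz_smul_left, ← hy, lorentz_add_left, lorentz_smul_left, hpv, zero_add]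
    have h2 := hv y hyP
    by_contra! h3
    nlinarith [mul_pos hε h3, mul_nonneg hr.le (neg_nonneg.mpr h2)]
  have h1 := key z hz
  have h2 := key (-z) (Submodule.neg_mem _ hz)
  rw [lorentz_neg_left] at h2
  linarith

/-- The ray from a relative interior point of a face in a direction violating a constraint leaves
the cone through some wall. -/
theorem exists_exit {p : HyperbolicSpace n} (hp : p ∈ face U S)
    (hpW : ∀ w ∈ U, w ∉ S → lorentz p.vec w < 0) {z : MinkowskiSpace n} (hz : z ∈ perp S)
    (hzU : ∃ w ∈ U, 0 < lorentz z w) :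
    ∃ w ∈ U, w ∉ S ∧ 0 < lorentz z w ∧
      ∀ v ∈ U, lorentz (lorentz z w • p.vec - lorentz p.vec w • z) v ≤ 0 := by
  classical
  obtain ⟨w₁, hw₁, hw₁'⟩ := hzU
  -- The ratio is the parameter at which `p + t z` hits the wall of `w`; the smallest one is the
  -- exit.
  obtain ⟨w, hw, hmin⟩ := Finset.exists_min_image (U.filter fun w => 0 < lorentz z w)
    (fun w => -lorentz p.vec w / lorentz z w) ⟨w₁, by simp [hw₁, hw₁']⟩
  rw [Finset.mem_filter] at hw
  have hwS : w ∉ S := fun h => by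
    have := hz w h
    linarith [hw.2]
  refine ⟨w, hw.1, hwS, hw.2, fun v hv => ?_⟩
  rw [lorentz_sub_left, lorentz_smul_left, lorentz_smul_left]
  have hpw := hpW w hw.1 hwS
  have hpv := hp.1 v hv
  by_cases h : 0 < lorentz z v
  · have := hmin v (by simp [hv, h])
    rw [div_le_div_iff₀ hw.2 h] at this
    linarith
  · nlinarith [mul_nonneg hw.2.le (neg_nonneg.mpr hpv),
      mul_nonneg (neg_pos.mpr hpw).le (neg_nonneg.mpr (not_lt.mp h))]

theorem mem_link_of_exit [DecidableEq (MinkowskiSpace n)] (hU : RightAngledSystem U)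
    {p : HyperbolicSpace n} (hp : p ∈ face U S)
    {z w : MinkowskiSpace n} (hz : z ∈ perp S) (hw : w ∈ U) (hwS : w ∉ S)
    (hq : lorentz z w • p.vec - lorentz p.vec w • z ≠ 0)
    (hqU : ∀ v ∈ U, lorentz (lorentz z w • p.vec - lorentz p.vec w • z) v ≤ 0) :
    w ∈ link U S := by
  obtain ⟨x, hx, r, hr, hqx⟩ := hU.exists_smul_of_mem_cone hq hqU
  have hxv : ∀ v, r * lorentz x.vec v =
      lorentz z w * lorentz p.vec v - lorentz p.vec w * lorentz z v := fun v => by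
    rw [← lorentz_smul_left, ← hqx, lorentz_sub_left, lorentz_smul_left, lorentz_smul_left]
  have h0 : ∀ v, lorentz z w * lorentz p.vec v - lorentz p.vec w * lorentz z v = 0 →
      lorentz x.vec v = 0 := fun v h => by
    have := hxv v
    rw [h] at this
    exact (mul_eq_zero.mp this).resolve_left hr.ne'
  refine mem_link.mpr ⟨hw, hwS, x, mem_face_insert.mpr ⟨⟨hx.1, fun v hv => h0 v ?_⟩, h0 w ?_⟩⟩
  · rw [hp.2 v hv, hz v hv]
    ring
  · ring

/-- A face of positive dimension has facets. -/
theorem link_nonempty (hU : RightAngledSystem U) (hS : S ⊆ U) (hne : (face U S).Nonempty)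
    (hcard : S.card < n) : (link U S).Nonempty := by
  classical
  obtain ⟨p, hp, hpW⟩ := hU.exists_relint hS hne
  have hfin := hU.finrank_perp_add_card hS hne
  -- A tangent direction to the face at `p`, available since `perp S` has dimension at least two. It
  -- cannot lie in the cone, whose nonzero vectors have negative product with `p`.
  obtain ⟨z, hz0, hzS, hzp⟩ : ∃ z, z ≠ 0 ∧ z ∈ perp S ∧ lorentz z p.vec = 0 := by
    set f : perp S →ₗ[ℝ] ℝ := ((lorentzForm n).flip p.vec).comp (perp S).subtype with hf
    have h1 : Module.finrank ℝ ℝ < Module.finrank ℝ (perp S) := by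
      rw [Module.finrank_self]
      omega
    obtain ⟨z, hz, hz0⟩ := Submodule.exists_mem_ne_zero_of_ne_bot
      (LinearMap.ker_ne_bot_of_finrank_lt (f := f) h1)
    exact ⟨z, fun h => hz0 (Subtype.ext h), z.2, hz⟩
  have hzU : ∃ w ∈ U, 0 < lorentz z w := by
    by_contra! h
    obtain ⟨x, -, r, hr, hx⟩ := hU.exists_smul_of_mem_cone hz0 h
    rw [hx, lorentz_smul_left] at hzp
    exact (lorentz_vec_neg x p).ne ((mul_eq_zero.mp hzp).resolve_left hr.ne')
  obtain ⟨w, hw, hwS, hzw, hq⟩ := exists_exit hp hpW hzS hzU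
  refine ⟨w, hU.mem_link_of_exit hp hzS hw hwS (fun h => ?_) hq⟩
  have h1 := congrArg (fun v => lorentz v p.vec) h
  simp only [lorentz_sub_left, lorentz_smul_left, p.lorentz_self, hzp, lorentz_zero_left] at h1
  linarith

/-- The cone over a face is cut out by the constraints of its facets. -/
theorem lorentz_nonpos_of_link (hU : RightAngledSystem U) (hS : S ⊆ U)
    (hne : (face U S).Nonempty) (hlink : (link U S).Nonempty) {z : MinkowskiSpace n}
    (hz : z ∈ perp S) (hzl : ∀ w ∈ link U S, lorentz z w ≤ 0) : ∀ w ∈ U, lorentz z w ≤ 0 := by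
  classical
  obtain ⟨p, hp, hpW⟩ := hU.exists_relint hS hne
  by_contra! hzU
  obtain ⟨w, hw, hwS, hzw, hq⟩ := exists_exit hp hpW hz hzU
  refine absurd (hzl w (hU.mem_link_of_exit hp hz hw hwS (fun h => ?_) hq)) hzw.not_ge
  obtain ⟨u, hu⟩ := hlink
  have hu' := mem_link.mp hu
  have h1 := congrArg (fun v => lorentz v u) h
  simp only [lorentz_sub_left, lorentz_smul_left, lorentz_zero_left] at h1
  nlinarith [mul_pos hzw (neg_pos.mpr (hpW u hu'.1 hu'.2.1)),
    mul_nonneg (neg_pos.mpr (hpW w hw hwS)).le (neg_nonneg.mpr (hzl u hu))]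

theorem link_orthogonal (hU : RightAngledSystem U) (hS : S ⊆ U) {u w : MinkowskiSpace n}
    (hu : u ∈ link U S) (hw : w ∈ S) : lorentz u w = 0 := by
  classical
  rw [mem_link] at hu
  exact hU.orthogonal (Finset.insert_subset hu.1 hS) hu.2.2 u (Finset.mem_insert_self _ _) w
    (Finset.mem_insert_of_mem hw) fun h => hu.2.1 (h ▸ hw)

/-- Disjoint facets of a face have normals at negative Lorentz product. -/
theorem lorentz_neg_of_disjoint [DecidableEq (MinkowskiSpace n)] (hU : RightAngledSystem U)
    (hS : S ⊆ U) {a b : MinkowskiSpace n}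
    (ha : a ∈ link U S) (hb : b ∈ link U S) (hab : a ≠ b)
    (hdisj : ¬ (face U (insert a (insert b S))).Nonempty) : lorentz a b < 0 := by
  have ha' := mem_link.mp ha
  have hb' := mem_link.mp hb
  refine lt_of_le_of_ne (hU.acute a ha'.1 b hb'.1 hab) fun h0 => hdisj ?_
  obtain ⟨p, hp, hpW⟩ := hU.exists_relint (Finset.insert_subset ha'.1 hS) ha'.2.2
  have hpb := hp.1 b hb'.1
  -- Were `a` and `b` orthogonal, projecting a point of the facet `a` onto the wall `b` would stay
  -- on `a`, and in the polytope by acuteness.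
  obtain ⟨y, r, hr, hy⟩ := exists_smul_vec_proj p (hU.unit b hb'.1)
  have hyv : ∀ v, r * lorentz y.vec v = lorentz p.vec v - lorentz p.vec b * lorentz b v :=
    fun v => by rw [← lorentz_smul_left, ← hy, lorentz_sub_left, lorentz_smul_left]
  have hyz : ∀ v, lorentz p.vec v - lorentz p.vec b * lorentz b v = 0 → lorentz y.vec v = 0 :=
    fun v h => by
      have := hyv v
      rw [h] at this
      exact (mul_eq_zero.mp this).resolve_left hr.ne'
  have hyb : lorentz y.vec b = 0 := hyz b (by rw [hU.unit b hb'.1]; ring)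
  rw [mem_face_insert] at hp
  refine ⟨y, mem_face_insert.mpr ⟨mem_face_insert.mpr ⟨⟨fun w hw => ?_, fun w hw => ?_⟩, hyb⟩, ?_⟩⟩
  · by_cases h : w = b
    · rw [h, hyb]
    · have h1 := hyv w
      have h2 := hU.acute b hb'.1 w hw (Ne.symm h)
      have h3 := hp.1.1 w hw
      by_contra! h4
      nlinarith [mul_pos hr h4, mul_nonneg (neg_nonneg.mpr hpb) (neg_nonneg.mpr h2)]
  · exact hyz w (by rw [hp.1.2 w hw, hU.link_orthogonal hS hb hw]; ring)
  · exact hyz a (by rw [hp.2, lorentz_comm b a, h0]; ring)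

/-- The supporting normal is the sum of the orthonormal family `S` divided by `√|S|`; a sum of
nonpositive terms vanishes only termwise. -/
theorem isFaceOfDim_face (hU : RightAngledSystem U) (hS : S ⊆ U) (hne : (face U S).Nonempty)
    {d : ℕ} (hd : d + S.card = n) : IsFaceOfDim (face U ∅) (face U S) d := by
  have hspan := hU.span_face hS hne
  have hfin := hU.finrank_perp_add_card hS hne
  refine ⟨⟨hne, ?_⟩, by rw [hspan]; omega⟩
  rcases S.eq_empty_or_nonempty with rfl | hS0
  · exact Or.inl rfl
  right
  set r := √(S.card : ℝ) with hr
  have hc : 0 < (S.card : ℝ) := by exact_mod_cast hS0.card_pos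
  have hr0 : 0 < r := Real.sqrt_pos.mpr hc
  have hrr : r * r = S.card := Real.mul_self_sqrt hc.le
  have hv : ∀ x : HyperbolicSpace n, lorentz x.vec (r⁻¹ • ∑ u ∈ S, u) =
      r⁻¹ * ∑ u ∈ S, lorentz x.vec u := fun x => by
    rw [lorentz_smul_right, lorentz_sum_right]
  refine ⟨r⁻¹ • ∑ u ∈ S, u, ?_, ?_, ?_⟩
  · have h1 : lorentz (∑ u ∈ S, u) (∑ u ∈ S, u) = S.card := by
      rw [lorentz_sum_left, Finset.card_eq_sum_ones, Nat.cast_sum]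
      refine Finset.sum_congr rfl fun u hu => ?_
      rw [lorentz_sum_right, Finset.sum_eq_single u
        (fun w hw hwu => hU.orthogonal hS hne u hu w hw hwu.symm) (fun h => absurd hu h),
        hU.unit u (hS hu), Nat.cast_one]
    rw [IsUnitNormal, lorentz_smul_left, lorentz_smul_right, h1, ← hrr]
    field_simp
  · intro x hx
    rw [halfSpace, Set.mem_ofPred_eq, hv]
    exact mul_nonpos_of_nonneg_of_nonpos (inv_pos.mpr hr0).le
      (Finset.sum_nonpos fun u hu => hx.1 u (hS hu))
  · ext x
    simp only [Set.mem_inter_iff, hyperplane, Set.mem_ofPred_eq, hv]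
    constructor
    · intro hx
      exact ⟨face_anti (Finset.empty_subset _) hx, by rw [Finset.sum_eq_zero hx.2, mul_zero]⟩
    · rintro ⟨hx, h⟩
      have h1 := (mul_eq_zero.mp h).resolve_left (inv_pos.mpr hr0).ne'
      rw [Finset.sum_eq_zero_iff_of_nonpos fun u hu => hx.1 u (hS hu)] at h1
      exact ⟨hx.1, h1⟩

/-- Let `S` collect the constraints tight on all of `F`. Adding points of `F` gives a point where
every other constraint is strict, and a supporting hyperplane through this point contains all of
`face U S`. -/
theorem exists_face_of_isFaceOfDim (hU : RightAngledSystem U) {F : Set (HyperbolicSpace n)}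
    {d : ℕ} (hF : IsFaceOfDim (face U ∅) F d) :
    ∃ S ⊆ U, F = face U S ∧ S.card + d = n := by
  classical
  obtain ⟨⟨⟨x₀, hx₀⟩, hF⟩, hdim⟩ := hF
  have hFP : F ⊆ face U ∅ := by
    rcases hF with rfl | ⟨v, -, -, rfl⟩
    · exact subset_rfl
    · exact Set.inter_subset_left
  have hcomb : ∀ x ∈ F, ∀ y ∈ F, ∃ z ∈ F, ∃ r : ℝ, 0 < r ∧ x.vec + y.vec = r • z.vec := by
    intro x hx y hy
    obtain ⟨z, r, hr, hz⟩ := exists_smul_vec_of_nonneg x y one_pos one_pos.le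
    rw [one_smul, one_smul] at hz
    have hzv : ∀ v, r * lorentz z.vec v = lorentz x.vec v + lorentz y.vec v := fun v => by
      rw [← lorentz_smul_left, ← hz, lorentz_add_left]
    have hzP : z ∈ face U ∅ := by
      refine ⟨fun w hw => ?_, by simp⟩
      have h1 := (hFP hx).1 w hw
      have h2 := (hFP hy).1 w hw
      have h3 := hzv w
      by_contra! h4
      nlinarith [mul_pos hr h4]
    refine ⟨z, ?_, r, hr, hz⟩
    rcases hF with rfl | ⟨v, -, -, rfl⟩
    · exact hzP
    · have h3 := hzv v
      rw [show lorentz x.vec v = 0 from hx.2, show lorentz y.vec v = 0 from hy.2, add_zero] at h3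
      exact ⟨hzP, (mul_eq_zero.mp h3).resolve_left hr.ne'⟩
  set S := U.filter fun w => ∀ x ∈ F, lorentz x.vec w = 0 with hS
  have hSU : S ⊆ U := Finset.filter_subset _ _
  have hFS : F ⊆ face U S := fun x hx => ⟨(hFP hx).1, fun w hw => (Finset.mem_filter.mp hw).2 x hx⟩
  have hrel : ∀ W : Finset (MinkowskiSpace n), W ⊆ U \ S →
      ∃ x ∈ F, ∀ w ∈ W, lorentz x.vec w < 0 := by
    intro W
    induction W using Finset.induction_on with
    | empty => exact fun _ => ⟨x₀, hx₀, by simp⟩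
    | insert w W hw ih =>
      intro hW
      obtain ⟨x, hx, hxW⟩ := ih ((Finset.subset_insert _ _).trans hW)
      have hwU := Finset.mem_sdiff.mp (hW (Finset.mem_insert_self _ _))
      obtain ⟨y, hy, hyw⟩ : ∃ y ∈ F, lorentz y.vec w ≠ 0 := by
        by_contra! h
        exact hwU.2 (Finset.mem_filter.mpr ⟨hwU.1, h⟩)
      obtain ⟨z, hz, r, hr, hxyz⟩ := hcomb x hx y hy
      have hzv : ∀ v, r * lorentz z.vec v = lorentz x.vec v + lorentz y.vec v := fun v => by
        rw [← lorentz_smul_left, ← hxyz, lorentz_add_left]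
      refine ⟨z, hz, fun v hv => ?_⟩
      have h1 := hzv v
      have h5 : r * lorentz z.vec v < 0 := by
        rw [h1]
        rcases Finset.mem_insert.mp hv with rfl | hv
        · exact add_neg_of_nonpos_of_neg ((hFP hx).1 v hwU.1)
            (lt_of_le_of_ne ((hFP hy).1 v hwU.1) hyw)
        · exact add_neg_of_neg_of_nonpos (hxW v hv)
            ((hFP hy).1 v (Finset.mem_sdiff.mp (hW (Finset.mem_insert_of_mem hv))).1)
      exact (pos_iff_neg_of_mul_neg h5).mp hr
  obtain ⟨p, hp, hpW⟩ := hrel (U \ S) subset_rfl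
  have hSF : face U S ⊆ F := by
    rcases hF with hF | ⟨v, -, hv, hF⟩
    · rw [hF]
      exact face_anti (Finset.empty_subset _)
    · intro y hy
      rw [hF] at hp ⊢
      refine ⟨face_anti (Finset.empty_subset _) hy, ?_⟩
      exact lorentz_eq_zero_of_supporting (hFS (hF ▸ hp))
        (fun w hw hwS => hpW w (Finset.mem_sdiff.mpr ⟨hw, hwS⟩)) hv hp.2 hy.2
  have hFeq := hFS.antisymm hSF
  have hne : (face U S).Nonempty := ⟨x₀, hFS hx₀⟩
  refine ⟨S, hSU, hFeq, ?_⟩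
  have h1 := hU.span_face hSU hne
  have h2 := hU.finrank_perp_add_card hSU hne
  rw [hFeq, h1] at hdim
  omega

end RightAngledSystem

/-! ### Symmetries act linearly and permute the normals -/

/-- Isometries of hyperbolic space are restrictions of linear Lorentz transformations. -/
theorem exists_linearMap_of_isometry (g : HyperbolicSpace n ≃ᵢ HyperbolicSpace n) :
    ∃ T : MinkowskiSpace n →ₗ[ℝ] MinkowskiSpace n, (∀ x : HyperbolicSpace n, T x.vec = (g x).vec) ∧
      (∀ u v, lorentz (T u) (T v) = lorentz u v) ∧ Function.Bijective T := by
  have hspan : Submodule.span ℝ (Set.range (vec : HyperbolicSpace n → MinkowskiSpace n)) = ⊤ := by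
    rw [← Set.image_univ]
    exact span_vec_image_eq (W := ∅) (x := basePoint n) (fun _ _ => trivial)
      (fun _ _ _ => trivial) trivial (by simp)
  obtain ⟨b, hb, hbspan, hbind⟩ :=
    exists_linearIndependent ℝ (Set.range (vec : HyperbolicSpace n → MinkowskiSpace n))
  set B : Module.Basis b ℝ (MinkowskiSpace n) := Module.Basis.mk hbind (by
    rw [Subtype.range_coe, hbspan, hspan]) with hB
  have hBapp : ∀ i, B i = i := fun i => by rw [hB, Module.Basis.mk_apply]
  choose pt hpt using fun i : b => hb i.2
  have hg : ∀ x y : HyperbolicSpace n, lorentz (g x).vec (g y).vec = lorentz x.vec y.vec := by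
    intro x y
    have h1 := cosh_dist (g x) (g y)
    rw [g.dist_eq, cosh_dist] at h1
    linarith
  set T := B.constr ℝ (fun i => (g (pt i)).vec) with hT
  have hTB : ∀ i, T (B i) = (g (pt i)).vec := fun i => by rw [hT, Module.Basis.constr_basis]
  have hBpt : ∀ i, B i = (pt i).vec := fun i => by rw [hBapp, hpt]
  have hpres : ∀ u v, lorentz (T u) (T v) = lorentz u v := by
    have : (lorentzForm n).compl₁₂ T T = lorentzForm n := by
      refine B.ext fun i => B.ext fun j => ?_
      rw [LinearMap.compl₁₂_apply, hTB, hTB, hBpt, hBpt]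
      exact hg _ _
    intro u v
    exact congrArg (fun f => f u v) this
  have hinj : Function.Injective T := by
    rw [injective_iff_map_eq_zero]
    intro u hu
    exact eq_zero_of_forall_lorentz fun v => by rw [← hpres, hu, lorentz_zero_left]
  have hsurj : Function.Surjective T := LinearMap.injective_iff_surjective.mp hinj
  refine ⟨T, fun x => ?_, hpres, hinj, hsurj⟩
  -- `T` agrees with `g` on a basis of points, and both preserve products of points, so the
  -- difference is orthogonal to the image of `T`, which is everything.
  rw [← sub_eq_zero]
  refine eq_zero_of_forall_lorentz fun v => ?_
  obtain ⟨y, rfl⟩ := hsurj v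
  have : (lorentzForm n (T x.vec - (g x).vec)).comp T = 0 := by
    refine B.ext fun i => ?_
    rw [LinearMap.comp_apply, lorentzForm_apply, lorentz_sub_left, hpres, hTB, hg, hBpt, sub_self,
      LinearMap.zero_apply]
  exact congrArg (fun f => f y) this

namespace RightAngledSystem

variable {U S : Finset (MinkowskiSpace n)}

theorem mem_iff_forall (hU : RightAngledSystem U) (hS : S ⊆ U) (hne : (face U S).Nonempty)
    {w : MinkowskiSpace n} (hw : w ∈ U) : w ∈ S ↔ ∀ x ∈ face U S, lorentz x.vec w = 0 := by
  refine ⟨fun h x hx => hx.2 w h, fun h => ?_⟩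
  by_contra hwS
  obtain ⟨p, hp, hpW⟩ := hU.exists_relint hS hne
  exact (hpW w hw hwS).ne (h p hp)

/-- Symmetries of the polytope permute the normals of its facets. -/
theorem map_mem (hU : RightAngledSystem U) {g : HyperbolicSpace n ≃ᵢ HyperbolicSpace n}
    (hg : g '' face U ∅ = face U ∅) {T : MinkowskiSpace n →ₗ[ℝ] MinkowskiSpace n}
    (hTg : ∀ x : HyperbolicSpace n, T x.vec = (g x).vec)
    (hT : ∀ u v, lorentz (T u) (T v) = lorentz u v) (hTb : Function.Bijective T)
    {u : MinkowskiSpace n} (hu : u ∈ U) (hne : (face U {u}).Nonempty) : T u ∈ U := by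
  obtain ⟨x, hx, hxW⟩ := hU.exists_relint (Finset.singleton_subset_iff.mpr hu) hne
  have hgP : ∀ y ∈ face U ∅, g y ∈ face U ∅ := fun y hy => hg ▸ Set.mem_image_of_mem g hy
  have hxP : x ∈ face U ∅ := face_anti (Finset.empty_subset _) hx
  have hxu : lorentz x.vec u = 0 := hx.2 u (Finset.mem_singleton_self u)
  -- If `g x` were interior, the supporting functional of `T u` would vanish identically.
  obtain ⟨w, hw, hxw⟩ : ∃ w ∈ U, lorentz (g x).vec w = 0 := by
    by_contra! h
    have := lorentz_eq_zero_of_supporting (S := ∅) (hgP x hxP)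
      (fun w hw _ => lt_of_le_of_ne ((hgP x hxP).1 w hw) (h w hw)) (v := T u)
      (fun y hy => ?_) (by rw [← hTg, hT, hxu]) (z := T u) (by simp [mem_perp])
    · rw [hT, hU.unit u hu] at this
      exact one_ne_zero this
    · rw [← hg] at hy
      obtain ⟨y, hy, rfl⟩ := hy
      rw [← hTg, hT]
      exact hy.1 u hu
  obtain ⟨v, rfl⟩ := hTb.2 w
  rw [← hTg, hT] at hxw
  have hvP : ∀ y ∈ face U ∅, lorentz y.vec v ≤ 0 := fun y hy => by
    rw [← hT, hTg]
    exact (hgP y hy).1 _ hw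
  -- The wall of `v` supports the polytope at a relative interior point of the facet `u`, so `v` is
  -- a multiple of `u`; unit norm leaves `±u`, and an interior point excludes `-u`.
  have hzu : lorentz (v - lorentz v u • u) u = 0 := by
    rw [lorentz_sub_left, lorentz_smul_left, hU.unit u hu]
    ring
  have hzv : lorentz (v - lorentz v u • u) v = 0 :=
    lorentz_eq_zero_of_supporting hx hxW hvP hxw (by simpa [mem_perp] using hzu)
  have hz0 : v - lorentz v u • u = 0 := by
    apply eq_zero_of_lorentz_self x
    · rw [lorentz_sub_left, lorentz_smul_left, lorentz_comm, hxw, lorentz_comm u, hxu]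
      ring
    · rw [lorentz_sub_right, lorentz_smul_right, hzu, hzv]
      ring
  rw [sub_eq_zero] at hz0
  have hvv : lorentz v v = 1 := by rw [← hT, hU.unit _ hw]
  obtain ⟨p, hp⟩ := hU.interior
  set t := lorentz v u with ht
  have ht2 : t * t = 1 := by
    rw [hz0, lorentz_smul_left, lorentz_smul_right, hU.unit u hu] at hvv
    linarith
  rcases mul_self_eq_one_iff.mp ht2 with h | h
  · rw [h, one_smul] at hz0
    rwa [← hz0]
  · have h1 := hvP p ⟨fun w hw => (hp w hw).le, by simp⟩
    rw [hz0, h, lorentz_smul_right] at h1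
    linarith [hp u hu]

theorem map_mem_iff (hU : RightAngledSystem U) {g : HyperbolicSpace n ≃ᵢ HyperbolicSpace n}
    {T : MinkowskiSpace n →ₗ[ℝ] MinkowskiSpace n}
    (hTg : ∀ x : HyperbolicSpace n, T x.vec = (g x).vec)
    (hT : ∀ u v, lorentz (T u) (T v) = lorentz u v)
    {S' : Finset (MinkowskiSpace n)} (hS : S ⊆ U) (hS' : S' ⊆ U) (hne : (face U S).Nonempty)
    (hgS : g '' face U S = face U S') {u : MinkowskiSpace n} (hu : u ∈ U) (hTu : T u ∈ U) :
    T u ∈ S' ↔ u ∈ S := by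
  rw [hU.mem_iff_forall hS hne hu, hU.mem_iff_forall hS' (hgS ▸ hne.image g) hTu, ← hgS,
    Set.forall_mem_image]
  refine forall₂_congr fun x _ => ?_
  rw [← hTg, hT]

/-- The linear extension of `g` permutes the link, hence fixes its sum, and it sends `a` to `b`. -/
theorem sum_link_lorentz_eq [DecidableEq (MinkowskiSpace n)] (hU : RightAngledSystem U)
    (hS : S ⊆ U) {a b : MinkowskiSpace n} (ha : a ∈ link U S) (hb : b ∈ link U S)
    {g : HyperbolicSpace n ≃ᵢ HyperbolicSpace n} (hgP : g '' face U ∅ = face U ∅)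
    (hgS : g '' face U S = face U S) (hgab : g '' face U (insert a S) = face U (insert b S)) :
    lorentz (∑ u ∈ link U S, u) a = lorentz (∑ u ∈ link U S, u) b := by
  obtain ⟨T, hTg, hT, hTb⟩ := exists_linearMap_of_isometry g
  have ha' := mem_link.mp ha
  have hb' := mem_link.mp hb
  have hne : (face U S).Nonempty := ha'.2.2.mono (face_anti (Finset.subset_insert _ _))
  have hTU : ∀ u ∈ link U S, T u ∈ U := fun u hu => by
    have hu' := mem_link.mp hu
    exact hU.map_mem hgP hTg hT hTb hu'.1 (hu'.2.2.mono (face_anti (by simp)))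
  have hTl : ∀ u ∈ link U S, T u ∈ link U S := fun u hu => by
    have hu' := mem_link.mp hu
    obtain ⟨x, hx⟩ := hu'.2.2
    rw [mem_face_insert] at hx
    refine mem_link.mpr ⟨hTU u hu, fun h => hu'.2.1 ?_, g x, mem_face_insert.mpr ⟨?_, ?_⟩⟩
    · exact (hU.map_mem_iff hTg hT hS hS hne hgS hu'.1 (hTU u hu)).mp h
    · exact hgS ▸ Set.mem_image_of_mem g hx.1
    · rw [← hTg, hT, hx.2]
  have hTab : T a = b := by
    have h1 := (hU.map_mem_iff hTg hT (Finset.insert_subset ha'.1 hS)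
      (Finset.insert_subset hb'.1 hS) ha'.2.2 hgab ha'.1 (hTU a ha)).mpr
      (Finset.mem_insert_self _ _)
    exact (Finset.mem_insert.mp h1).resolve_right (mem_link.mp (hTl a ha)).2.1
  have himage : (link U S).image T = link U S := by
    refine Finset.eq_of_subset_of_card_le (Finset.image_subset_iff.mpr hTl) ?_
    rw [Finset.card_image_of_injective _ hTb.1]
  have hsum : T (∑ u ∈ link U S, u) = ∑ u ∈ link U S, u := by
    rw [map_sum]
    conv_rhs => rw [← himage]
    rw [Finset.sum_image fun u _ v _ h => hTb.1 h]
  rw [← hT, hsum, hTab]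

theorem card_le (hU : RightAngledSystem U) (hS : S ⊆ U) (hne : (face U S).Nonempty) :
    S.card ≤ n := by
  have h1 := hU.finrank_perp_add_card hS hne
  obtain ⟨x, hx⟩ := hne
  have : 0 < Module.finrank ℝ (perp S) := by
    rw [Module.finrank_pos_iff_exists_ne_zero]
    exact ⟨⟨x.vec, hx.2⟩, fun h => vec_ne_zero x (congrArg Subtype.val h)⟩
  omega

/-! ### Flags, edge lengths and centres of faces -/

/-- Every face has a vertex. -/
theorem exists_vertex (hU : RightAngledSystem U) (hS : S ⊆ U) (hne : (face U S).Nonempty) :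
    ∃ T ⊆ U, S ⊆ T ∧ (face U T).Nonempty ∧ T.card = n := by
  classical
  induction hk : n - S.card generalizing S with
  | zero => exact ⟨S, hS, subset_rfl, hne, by have := hU.card_le hS hne; omega⟩
  | succ k ih =>
    obtain ⟨u, hu⟩ := hU.link_nonempty hS hne (by omega)
    rw [mem_link] at hu
    obtain ⟨T, hT, hST, h⟩ := ih (Finset.insert_subset hu.1 hS) hu.2.2 (by
      rw [Finset.card_insert_of_notMem hu.2.1]
      omega)
    exact ⟨T, hT, (Finset.subset_insert _ _).trans hST, h⟩

/-- The flag of faces obtained by intersecting facets one after the other. -/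
theorem exists_barycentricSimplex [DecidableEq (MinkowskiSpace n)] (hU : RightAngledSystem U)
    {l : List (MinkowskiSpace n)} (hl : l.Nodup) (hlen : l.length = n) (hlU : l.toFinset ⊆ U)
    (hne : (face U l.toFinset).Nonempty) :
    ∃ σ : BarycentricSimplex (face U ∅), ∀ i, σ.face i = face U (l.take (n - i)).toFinset := by
  have hsub : ∀ k, (l.take k).toFinset ⊆ l.toFinset := fun k u hu => by
    rw [List.mem_toFinset] at hu ⊢
    exact List.mem_of_mem_take hu
  refine ⟨⟨fun i => face U (l.take (n - i)).toFinset, fun i => ?_, fun i j hij => ?_⟩,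
    fun i => rfl⟩
  · refine hU.isFaceOfDim_face ((hsub _).trans hlU) (hne.mono (face_anti (hsub _))) ?_
    rw [List.toFinset_card_of_nodup (hl.sublist (List.take_sublist _ _)), List.length_take, hlen]
    omega
  · refine face_anti fun u hu => ?_
    rw [List.mem_toFinset] at hu ⊢
    exact (List.take_subset_take_left l (Nat.sub_le_sub_left hij n)) hu

theorem exists_barycentricSimplex_link [DecidableEq (MinkowskiSpace n)] (hU : RightAngledSystem U)
    (hS : S ⊆ U) {a : MinkowskiSpace n} (ha : a ∈ link U S) :
    ∃ σ : BarycentricSimplex (face U ∅),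
      (∀ i : Fin (n + 1), i + S.card = n → σ.face i = face U S) ∧
      ∀ i : Fin (n + 1), i + (S.card + 1) = n → σ.face i = face U (insert a S) := by
  rw [mem_link] at ha
  obtain ⟨T, hTU, haT, hTne, hTcard⟩ := hU.exists_vertex (Finset.insert_subset ha.1 hS) ha.2.2
  -- Listing `S` first, then `a`, then the other walls at a vertex makes the flag pass through `face
  -- U S` and its facet on `a`.
  set l := S.toList ++ a :: (T \ insert a S).toList with hl
  have hlT : l.toFinset = T := by
    ext u
    have := @haT u
    simp only [Finset.mem_insert] at this
    simp only [hl, List.mem_toFinset, List.mem_append, Finset.mem_toList, List.mem_cons,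
      Finset.mem_sdiff, Finset.mem_insert]
    tauto
  have hnd : l.Nodup := by
    rw [hl, List.nodup_append]
    refine ⟨Finset.nodup_toList _, List.nodup_cons.mpr ⟨by simp, Finset.nodup_toList _⟩, ?_⟩
    intro u hu v hv huv
    subst huv
    simp only [Finset.mem_toList] at hu
    simp only [List.mem_cons, Finset.mem_toList, Finset.mem_sdiff, Finset.mem_insert] at hv
    rcases hv with rfl | hv
    · exact ha.2.1 hu
    · exact hv.2 (Or.inr hu)
  have hlen : l.length = n := by rw [← List.toFinset_card_of_nodup hnd, hlT, hTcard]
  obtain ⟨σ, hσ⟩ := hU.exists_barycentricSimplex hnd hlen (hlT ▸ hTU) (hlT ▸ hTne)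
  refine ⟨σ, fun i hi => ?_, fun i hi => ?_⟩
  · rw [hσ, show n - (i : ℕ) = S.toList.length by rw [Finset.length_toList]; omega, hl,
      List.take_left, Finset.toList_toFinset]
  · rw [hσ, show n - (i : ℕ) = S.toList.length + 1 by rw [Finset.length_toList]; omega, hl,
      List.take_length_add_append]
    congr 1
    ext u
    simp

/-- All edges of a regular polytope have the same length. -/
theorem diam_edge_eq (hU : RightAngledSystem U) (hreg : IsRegular (face U ∅)) {L : ℝ}
    (hL : ∃ E, IsEdge (face U ∅) E ∧ edgeLength E = L) (hS : S ⊆ U) (hne : (face U S).Nonempty)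
    (hcard : S.card + 1 = n) : Metric.diam (face U S) = L := by
  classical
  obtain ⟨E, hE, rfl⟩ := hL
  obtain ⟨S₀, hS₀, rfl, hcard₀⟩ := hU.exists_face_of_isFaceOfDim hE
  obtain ⟨a, ha⟩ := hU.link_nonempty hS hne (by omega)
  obtain ⟨b, hb⟩ := hU.link_nonempty hS₀ hE.1.1 (by omega)
  obtain ⟨σ, hσ, -⟩ := hU.exists_barycentricSimplex_link hS ha
  obtain ⟨τ, hτ, -⟩ := hU.exists_barycentricSimplex_link hS₀ hb
  obtain ⟨g, -, hg⟩ := hreg τ σ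
  have h := hg ⟨1, by omega⟩
  rw [hσ _ (by simp only; omega), hτ _ (by simp only; omega)] at h
  rw [edgeLength, ← h, g.isometry.diam_image]

/-- The sum of the normals of the facets of a face of a regular polytope is a centre: it has the
same product with all of these normals. -/
theorem exists_center (hU : RightAngledSystem U) (hreg : IsRegular (face U ∅)) (hS : S ⊆ U)
    (hlink : (link U S).Nonempty) :
    ∃ c ∈ perp S, ∃ κ : ℝ, κ ≠ 0 ∧ ∀ u ∈ link U S, lorentz c u = κ := by
  classical
  obtain ⟨a, ha⟩ := hlink
  have ha' := mem_link.mp ha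
  have hne : (face U S).Nonempty := ha'.2.2.mono (face_anti (Finset.subset_insert _ _))
  set c := ∑ u ∈ link U S, u with hc
  have hcS : c ∈ perp S := fun w hw => by
    rw [hc, lorentz_sum_left, Finset.sum_eq_zero fun u hu => hU.link_orthogonal hS hu hw]
  have hconst : ∀ u ∈ link U S, lorentz c u = lorentz c a := by
    intro u hu
    have hu' := mem_link.mp hu
    have hcard := hU.card_le (Finset.insert_subset ha'.1 hS) ha'.2.2
    rw [Finset.card_insert_of_notMem ha'.2.1] at hcard
    obtain ⟨σ, hσ, hσ'⟩ := hU.exists_barycentricSimplex_link hS hu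
    obtain ⟨τ, hτ, hτ'⟩ := hU.exists_barycentricSimplex_link hS ha
    obtain ⟨g, hgP, hg⟩ := hreg σ τ
    have h1 := hg ⟨n - S.card, by omega⟩
    have h2 := hg ⟨n - (S.card + 1), by omega⟩
    rw [hσ _ (by simp only; omega), hτ _ (by simp only; omega)] at h1
    rw [hσ' _ (by simp only; omega), hτ' _ (by simp only; omega)] at h2
    exact hU.sum_link_lorentz_eq hS hu ha hgP h1 h2
  refine ⟨c, hcS, lorentz c a, fun h0 => ?_, hconst⟩
  obtain ⟨p, hp, hpW⟩ := hU.exists_relint hS hne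
  have hc0 : c ≠ 0 := fun h => by
    have h1 : lorentz p.vec c < 0 := by
      rw [hc, lorentz_sum_right]
      exact Finset.sum_neg (fun u hu => hpW u (mem_link.mp hu).1 (mem_link.mp hu).2.1) ⟨a, ha⟩
    rw [h, lorentz_zero_right] at h1
    exact lt_irrefl _ h1
  -- If the common product were zero, both `c` and `-c` would lie in the cone, yet nonzero vectors
  -- of the cone have positive time coordinate.
  obtain ⟨x, -, r, hr, hx⟩ := hU.exists_smul_of_mem_cone hc0
    (hU.lorentz_nonpos_of_link hS hne ⟨a, ha⟩ hcS fun u hu => by rw [hconst u hu, h0])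
  obtain ⟨y, -, s, hs, hy⟩ := hU.exists_smul_of_mem_cone (neg_ne_zero.mpr hc0)
    (hU.lorentz_nonpos_of_link hS hne ⟨a, ha⟩ (Submodule.neg_mem _ hcS) fun u hu => by
      rw [lorentz_neg_left, hconst u hu, h0, neg_zero])
  have h1 := congrArg Prod.fst hx
  have h2 := congrArg Prod.fst hy
  simp only [Prod.smul_fst, smul_eq_mul, Prod.fst_neg] at h1 h2
  linarith [mul_pos hr x.time_pos, mul_pos hs y.time_pos]

end RightAngledSystem

/-! ### Distances between disjoint facets -/

/-- The upper bound `cosh (r - s) ≤ cosh t` for `0 ≤ r, s ≤ t`, in terms of `cosh` and `sinh`. -/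
theorem cosh_sub_le {α β α' β' f h : ℝ} (hα : 1 ≤ α) (hα' : 1 ≤ α') (hβ : 0 ≤ β) (hβ' : 0 ≤ β')
    (h1 : α ^ 2 = 1 + β ^ 2) (h2 : α' ^ 2 = 1 + β' ^ 2) (hf : 0 < f)
    (hfh : f ^ 2 = 1 + h ^ 2) (hb : β * f ≤ α * h) (hb' : β' * f ≤ α' * h) :
    α * α' - β * β' ≤ f := by
  -- The last premise reads `tanh r ≤ tanh t`, where `α = cosh r`, `β = sinh r`, `f = cosh t`, `h =
  -- sinh t`.
  have aux : ∀ {α β : ℝ}, 1 ≤ α → 0 ≤ β → α ^ 2 = 1 + β ^ 2 → β * f ≤ α * h → α ≤ f := by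
    intro α β hα hβ h1 hb
    have h3 : (β * f) ^ 2 ≤ (α * h) ^ 2 := pow_le_pow_left₀ (by positivity) hb 2
    rw [mul_pow, mul_pow, hfh, h1] at h3
    exact le_of_sq_le_sq (by nlinarith) hf.le
  have main : ∀ {α β α' β' : ℝ}, 1 ≤ α → 1 ≤ α' → 0 ≤ β → 0 ≤ β' → α ^ 2 = 1 + β ^ 2 →
      α' ^ 2 = 1 + β' ^ 2 → β' ≤ β → α * α' - β * β' ≤ α := by
    intro α β α' β' hα hα' hβ hβ' h1 h2 hle
    have h3 : α * β' ≤ β * α' := by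
      apply le_of_sq_le_sq _ (by positivity)
      rw [mul_pow, mul_pow, h1, h2]
      nlinarith
    have h4 : α * (α' - 1) * (α' + 1) ≤ β * β' * (α' + 1) := by
      have h5 : α * (α' - 1) * (α' + 1) = α * β' * β' := by
        linear_combination α * h2
      rw [h5]
      nlinarith [mul_le_mul_of_nonneg_right h3 hβ', mul_nonneg hβ hβ']
    have := le_of_mul_le_mul_right h4 (by linarith)
    linarith
  rcases le_total β' β with hle | hle
  · exact (main hα hα' hβ hβ' h1 h2 hle).trans (aux hα hβ h1 hb)
  · have := (main hα' hα hβ' hβ h2 h1 hle).trans (aux hα' hβ' h2 hb')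
    linarith

namespace RightAngledSystem

variable {U S : Finset (MinkowskiSpace n)}

/-- This is where regularity drives the descent: some neighbour of `b` is strictly closer to `a`.
Otherwise subtracting from `a` the multiple of the centre that kills the product with `b` gives a
vector in the cone over the facet `b`, but its product with `a` is `1 - ⟨a, b⟩ > 0`. -/
theorem exists_link_lt [DecidableEq (MinkowskiSpace n)] (hU : RightAngledSystem U)
    (hreg : IsRegular (face U ∅)) (hS : S ⊆ U) (hcard : S.card + 1 < n) {a b : MinkowskiSpace n}
    (ha : a ∈ link U S) (hb : b ∈ link U S) (hab : a ≠ b) :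
    ∃ w ∈ link U (insert b S), lorentz a b < lorentz a w := by
  have ha' := mem_link.mp ha
  have hb' := mem_link.mp hb
  obtain ⟨c, hcS, κ, hκ, hc⟩ := hU.exists_center hreg hS ⟨a, ha⟩
  by_contra! h
  set τ := lorentz a b / κ with hτ
  have hτκ : τ * κ = lorentz a b := div_mul_cancel₀ _ hκ
  have hzv : ∀ v ∈ link U S, lorentz (a - τ • c) v = lorentz a v - lorentz a b := fun v hv => by
    rw [lorentz_sub_left, lorentz_smul_left, hc v hv, hτκ]
  have hz : a - τ • c ∈ perp (insert b S) := by
    intro w hw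
    rcases Finset.mem_insert.mp hw with rfl | hw
    · rw [hzv w hb, sub_self]
    · rw [lorentz_sub_left, lorentz_smul_left, hU.link_orthogonal hS ha hw, hcS w hw]
      ring
  have hlink := hU.link_nonempty (Finset.insert_subset hb'.1 hS) hb'.2.2 (by
    rwa [Finset.card_insert_of_notMem hb'.2.1])
  have h1 := hU.lorentz_nonpos_of_link (Finset.insert_subset hb'.1 hS) hb'.2.2 hlink hz
    (fun w hw => by
      rw [hzv w (link_insert_subset hw)]
      linarith [h w hw]) a ha'.1
  rw [hzv a ha, hU.unit a ha'.1] at h1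
  linarith [hU.acute a ha'.1 b hb'.1 hab]

/-- The plane containing an edge is spanned by an endpoint and the normal at that endpoint. -/
theorem edge_decomposition [DecidableEq (MinkowskiSpace n)] (hU : RightAngledSystem U)
    (hS : S ⊆ U) (hcard : S.card + 1 = n) {a : MinkowskiSpace n} (ha : a ∈ link U S)
    {v : HyperbolicSpace n} (hv : v ∈ face U (insert a S)) {z : MinkowskiSpace n}
    (hz : z ∈ perp S) : z = -lorentz z v.vec • v.vec + lorentz z a • a := by
  have ha' := mem_link.mp ha
  have hfin := hU.finrank_perp_add_card (Finset.insert_subset ha'.1 hS) ha'.2.2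
  rw [Finset.card_insert_of_notMem ha'.2.1] at hfin
  have h1 : Module.finrank ℝ (perp (insert a S)) = 1 := by omega
  have hva : lorentz v.vec a = 0 := hv.2 a (Finset.mem_insert_self _ _)
  set r := z - (-lorentz z v.vec • v.vec + lorentz z a • a) with hr
  have hrv : ∀ y, lorentz r y =
      lorentz z y + lorentz z v.vec * lorentz v.vec y - lorentz z a * lorentz a y := fun y => by
    rw [hr, lorentz_sub_left, lorentz_add_left, lorentz_smul_left, lorentz_smul_left]
    ring
  have hrp : r ∈ perp (insert a S) := by
    intro w hw
    rw [hrv]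
    rcases Finset.mem_insert.mp hw with rfl | hw
    · rw [hva, hU.unit w ha'.1]
      ring
    · rw [hz w hw, hv.2 w (Finset.mem_insert_of_mem hw), hU.link_orthogonal hS ha hw]
      ring
  obtain ⟨t, ht⟩ := exists_smul_eq_of_finrank_eq_one h1
    (x := (⟨v.vec, hv.2⟩ : perp (insert a S))) (fun h => vec_ne_zero v (congrArg Subtype.val h))
    ⟨r, hrp⟩
  have ht' : t • v.vec = r := congrArg Subtype.val ht
  have h2 : lorentz r v.vec = 0 := by
    rw [hrv, v.lorentz_self, lorentz_comm a, hva]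
    ring
  rw [← ht', lorentz_smul_left, v.lorentz_self] at h2
  have ht0 : t = 0 := by linarith
  rw [ht0, zero_smul, eq_comm, hr, sub_eq_zero] at ht'
  exact ht'

/-- Use the endpoint `v` on the wall `a` as origin: a point of the edge is `cosh r • v - sinh r •
a`, and `b` projects to the same plane without loss, as `h • v - f • a` with `f = cosh t`, `h = sinh
t`. The constraint of `b` says `r ≤ t`, so two points of the edge are at distance at most `t`. -/
theorem cosh_diam_le_of_edge [DecidableEq (MinkowskiSpace n)] (hU : RightAngledSystem U)
    (hS : S ⊆ U) (hcard : S.card + 1 = n) {a b : MinkowskiSpace n} (ha : a ∈ link U S)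
    (hb : b ∈ link U S) (hab : lorentz a b < 0) :
    Real.cosh (Metric.diam (face U S)) ≤ -lorentz a b := by
  have ha' := mem_link.mp ha
  have hb' := mem_link.mp hb
  obtain ⟨v, hv⟩ := ha'.2.2
  set f := -lorentz a b with hf
  set h := -lorentz v.vec b with hh
  have hva : lorentz v.vec a = 0 := hv.2 a (Finset.mem_insert_self _ _)
  have hdec : ∀ p ∈ perp S, ∀ y, lorentz p y =
      -lorentz p v.vec * lorentz v.vec y + lorentz p a * lorentz a y := fun p hp y => by
    conv_lhs => rw [hU.edge_decomposition hS hcard ha hv hp]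
    rw [lorentz_add_left, lorentz_smul_left, lorentz_smul_left]
  have hf0 : 0 < f := by linarith
  have hfh : f ^ 2 = 1 + h ^ 2 := by
    have := hdec b (fun w hw => hU.link_orthogonal hS hb hw) b
    rw [hU.unit b hb'.1, lorentz_comm b v.vec, lorentz_comm b a] at this
    rw [hf, hh]
    linarith
  have hface : ∀ p ∈ face U S, 1 ≤ -lorentz p.vec v.vec ∧ 0 ≤ -lorentz p.vec a ∧
      (-lorentz p.vec v.vec) ^ 2 = 1 + (-lorentz p.vec a) ^ 2 ∧
      (-lorentz p.vec a) * f ≤ (-lorentz p.vec v.vec) * h := by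
    intro p hp
    refine ⟨one_le_neg_lorentz p v, by linarith [hp.1 a ha'.1], ?_, ?_⟩
    · have := hdec p.vec hp.2 p.vec
      rw [p.lorentz_self, lorentz_comm v.vec, lorentz_comm a] at this
      linarith
    · have h1 := hdec p.vec hp.2 b
      have h2 := hp.1 b hb'.1
      rw [h1] at h2
      rw [hf, hh]
      linarith
  have hf1 : 1 ≤ f := by nlinarith
  have hdiam : Metric.diam (face U S) ≤ Real.arcosh f := by
    refine Metric.diam_le_of_forall_dist_le (Real.arcosh_nonneg hf1) fun p hp q hq => ?_
    obtain ⟨h1, h2, h3, h4⟩ := hface p hp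
    obtain ⟨h1', h2', h3', h4'⟩ := hface q hq
    rw [← abs_of_nonneg (dist_nonneg (x := p) (y := q)),
      ← abs_of_nonneg (Real.arcosh_nonneg hf1), ← Real.cosh_le_cosh, cosh_dist,
      Real.cosh_arcosh hf1]
    have h5 := cosh_sub_le h1 h1' h2 h2' h3 h3' hf0 hfh h4 h4'
    have h6 := hdec p.vec hp.2 q.vec
    rw [lorentz_comm v.vec, lorentz_comm a] at h6
    rw [h6]
    linarith
  rw [← Real.cosh_arcosh hf1, Real.cosh_le_cosh, abs_of_nonneg Metric.diam_nonneg,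
    abs_of_nonneg (Real.arcosh_nonneg hf1)]
  exact hdiam

/-- The distance of disjoint facets of a face is at least the edge length, and facets realizing
it are joined by an edge. -/
theorem cosh_le_of_disjoint [DecidableEq (MinkowskiSpace n)] (hU : RightAngledSystem U)
    (hreg : IsRegular (face U ∅)) {L : ℝ}
    (hL : ∀ S ⊆ U, (face U S).Nonempty → S.card + 1 = n → Metric.diam (face U S) = L)
    (hS : S ⊆ U) {k : ℕ} (hk : S.card + 1 + k = n) {a b : MinkowskiSpace n}
    (ha : a ∈ link U S) (hb : b ∈ link U S) (hab : a ≠ b)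
    (hdisj : ¬ (face U (insert a (insert b S))).Nonempty) :
    Real.cosh L ≤ -lorentz a b ∧ (-lorentz a b = Real.cosh L →
      ∃ S' ⊆ U, S'.card + 1 = n ∧ a ∈ link U S' ∧ b ∈ link U S') := by
  induction k generalizing S b with
  | zero =>
    have ha' := mem_link.mp ha
    refine ⟨?_, fun _ => ⟨S, hS, hk, ha, hb⟩⟩
    rw [← hL S hS (ha'.2.2.mono (face_anti (Finset.subset_insert _ _))) hk]
    exact hU.cosh_diam_le_of_edge hS hk ha hb (hU.lorentz_neg_of_disjoint hS ha hb hab hdisj)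
  | succ k ih =>
    classical
    have ha' := mem_link.mp ha
    set D := (link U S).filter fun b => a ≠ b ∧ ¬ (face U (insert a (insert b S))).Nonempty
      with hD
    have hmemD : ∀ b, b ∈ D ↔ b ∈ link U S ∧ a ≠ b ∧
        ¬ (face U (insert a (insert b S))).Nonempty := fun b => by rw [hD, Finset.mem_filter]
    have step : ∀ b ∈ D, (∀ b' ∈ D, lorentz a b' ≤ lorentz a b) →
        Real.cosh L ≤ -lorentz a b ∧ (-lorentz a b = Real.cosh L →
          ∃ S' ⊆ U, S'.card + 1 = n ∧ a ∈ link U S' ∧ b ∈ link U S') := by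
      intro b hbD hmax
      obtain ⟨hb, hab, hdisj⟩ := (hmemD b).mp hbD
      have hb' := mem_link.mp hb
      -- By maximality of `b` the closer wall `w` is not disjoint from `a`, so both `a` and `b`
      -- bound the smaller face on `w`.
      obtain ⟨w, hw, hlt⟩ := hU.exists_link_lt hreg hS (by omega) ha hb hab
      have hw' := mem_link.mp hw
      have hwS := link_insert_subset hw
      have hwS' := mem_link.mp hwS
      have haw : a ≠ w := fun h => hdisj (h ▸ hw'.2.2)
      have hne : (face U (insert a (insert w S))).Nonempty := by
        by_contra h
        exact absurd (hmax w ((hmemD w).mpr ⟨hwS, haw, h⟩)) hlt.not_ge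
      refine ih (Finset.insert_subset hw'.1 hS)
        (by rw [Finset.card_insert_of_notMem hwS'.2.1]; omega) ?_ ?_ hab ?_
      · exact mem_link.mpr ⟨ha'.1, by simp [haw, ha'.2.1], hne⟩
      · refine mem_link.mpr ⟨hb'.1, ?_, Finset.insert_comm w b S ▸ hw'.2.2⟩
        have hbw : b ≠ w := fun h => hw'.2.1 (by simp [h])
        simp [hbw, hb'.2.1]
      · exact fun h => hdisj (h.mono (face_anti (Finset.insert_subset_insert _
          (Finset.insert_subset_insert _ (Finset.subset_insert _ _)))))
    obtain ⟨m, hm, hmax⟩ := Finset.exists_max_image D (lorentz a)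
      ⟨b, (hmemD b).mpr ⟨hb, hab, hdisj⟩⟩
    have hbD : b ∈ D := (hmemD b).mpr ⟨hb, hab, hdisj⟩
    rcases (hmax b hbD).eq_or_lt with heq | hlt
    · exact step b hbD fun b' hb' => heq ▸ hmax b' hb'
    -- A non-maximal `b` satisfies the bound strictly, so the equality case is vacuous.
    · have := (step m hm hmax).1
      exact ⟨by linarith, fun h => by linarith⟩

end RightAngledSystem

/-! ### Equality cases and shortest paths -/

theorem lorentz_sq_le_one_add (y : HyperbolicSpace n) {a b : MinkowskiSpace n}
    (ha : lorentz a a = 1) (hb : lorentz b b = 1) (hyb : lorentz y.vec b = 0) :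
    lorentz a b ^ 2 ≤ 1 + lorentz y.vec a ^ 2 := by
  have h := lorentz_sq_le y b (a + lorentz y.vec a • y.vec) (by rw [lorentz_comm, hyb]) (by
    rw [lorentz_add_left, lorentz_smul_left, y.lorentz_self, lorentz_comm a]
    ring)
  simp only [lorentz_add_left, lorentz_add_right, lorentz_smul_left, lorentz_smul_right,
    y.lorentz_self, ha, hb, lorentz_comm b y.vec, hyb, lorentz_comm b a,
    lorentz_comm a y.vec] at h
  linarith

/-- Cauchy-Schwarz in the tangent space at `x`, for `a` and the component of `y`. Chained with
`lorentz_sq_le_one_add`, it bounds the distance between points of two hyperplanes from below. -/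
theorem one_add_sq_le_lorentz_sq (x y : HyperbolicSpace n) {a : MinkowskiSpace n}
    (ha : lorentz a a = 1) (hxa : lorentz x.vec a = 0) :
    1 + lorentz y.vec a ^ 2 ≤ lorentz x.vec y.vec ^ 2 := by
  have h := lorentz_sq_le x a (y.vec + lorentz x.vec y.vec • x.vec) (by rw [lorentz_comm, hxa]) (by
    rw [lorentz_add_left, lorentz_smul_left, x.lorentz_self, lorentz_comm y.vec]
    ring)
  simp only [lorentz_add_left, lorentz_add_right, lorentz_smul_left, lorentz_smul_right,
    x.lorentz_self, y.lorentz_self, ha, lorentz_comm a x.vec, hxa, lorentz_comm a y.vec,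
    lorentz_comm y.vec x.vec] at h
  linarith

/-- Points of two hyperplanes realizing the distance between these lie on the common
perpendicular. -/
theorem lorentz_eq_zero_of_dist_eq (x y : HyperbolicSpace n) {a b w : MinkowskiSpace n}
    (ha : lorentz a a = 1) (hb : lorentz b b = 1) (hxa : lorentz x.vec a = 0)
    (hyb : lorentz y.vec b = 0) (hya : lorentz y.vec a ≠ 0)
    (heq : lorentz x.vec y.vec ^ 2 = lorentz a b ^ 2)
    (haw : lorentz a w = 0) (hbw : lorentz b w = 0) :
    lorentz x.vec w = 0 ∧ lorentz y.vec w = 0 := by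
  have h1 := lorentz_sq_le_one_add y ha hb hyb
  have h2 := one_add_sq_le_lorentz_sq x y ha hxa
  -- The hypothesis `heq` makes both Cauchy-Schwarz inequalities sharp, so `y` is a combination of
  -- `a` and `b`, and then `x` one of `a` and `y`.
  have hY : a + lorentz y.vec a • y.vec - lorentz a b • b = 0 := by
    apply eq_zero_of_lorentz_self y
    · simp only [lorentz_sub_left, lorentz_add_left, lorentz_smul_left, y.lorentz_self,
        lorentz_comm b y.vec, hyb, lorentz_comm a y.vec]
      ring
    · simp only [lorentz_sub_left, lorentz_add_left, lorentz_smul_left, lorentz_sub_right,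
        lorentz_add_right, lorentz_smul_right, y.lorentz_self,
        lorentz_comm b y.vec, hyb, lorentz_comm a y.vec, lorentz_comm b a, ha, hb]
      linarith
  have hX : y.vec + lorentz x.vec y.vec • x.vec - lorentz y.vec a • a = 0 := by
    apply eq_zero_of_lorentz_self x
    · simp only [lorentz_sub_left, lorentz_add_left, lorentz_smul_left, x.lorentz_self,
        lorentz_comm a x.vec, hxa, lorentz_comm y.vec x.vec]
      ring
    · simp only [lorentz_sub_left, lorentz_add_left, lorentz_smul_left, lorentz_sub_right,
        lorentz_add_right, lorentz_smul_right, y.lorentz_self, x.lorentz_self,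
        lorentz_comm a x.vec, hxa, lorentz_comm a y.vec, lorentz_comm y.vec x.vec, ha]
      linarith
  have hy : lorentz y.vec w = 0 := by
    have := congrArg (fun z => lorentz z w) hY
    simp only [lorentz_sub_left, lorentz_add_left, lorentz_smul_left, lorentz_zero_left, haw, hbw,
      zero_add, mul_zero, sub_zero] at this
    exact (mul_eq_zero.mp this).resolve_left hya
  have hx := congrArg (fun z => lorentz z w) hX
  simp only [lorentz_sub_left, lorentz_add_left, lorentz_smul_left, lorentz_zero_left, haw, hy,
    zero_add, mul_zero, sub_zero] at hx
  exact ⟨(mul_eq_zero.mp hx).resolve_left (lorentz_vec_neg x y).ne, hy⟩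

/-- A point at which the triangle inequality is sharp lies on the line through the others. -/
theorem lorentz_eq_zero_of_dist_add_dist (x y p : HyperbolicSpace n) (hxy : x ≠ y)
    (h : dist x p + dist p y = dist x y) {w : MinkowskiSpace n} (hx : lorentz x.vec w = 0)
    (hy : lorentz y.vec w = 0) : lorentz p.vec w = 0 := by
  have hA := cosh_dist x p
  have hB := cosh_dist p y
  have hC := cosh_dist x y
  have hpos : 0 < dist x p + dist p y := h ▸ dist_pos.mpr hxy
  rw [← h, Real.cosh_add] at hC
  have hs := Real.sinh_pos_iff.mpr hpos
  rw [Real.sinh_add] at hs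
  set A := dist x p
  set B := dist p y
  have hA2 := Real.cosh_sq A
  have hB2 := Real.cosh_sq B
  -- The initial directions from `p` to `x` and to `y` are opposite; the combination balances their
  -- lengths `sinh A` and `sinh B`.
  have hz : Real.sinh B • (x.vec + lorentz x.vec p.vec • p.vec) +
      Real.sinh A • (y.vec + lorentz y.vec p.vec • p.vec) = 0 := by
    apply eq_zero_of_lorentz_self p
    · rw [lorentz_add_left, lorentz_smul_left, lorentz_smul_left, lorentz_component_orth,
        lorentz_component_orth]
      ring
    · rw [lorentz_add_left, lorentz_add_right, lorentz_add_right]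
      simp only [lorentz_smul_left, lorentz_smul_right, lorentz_component, x.lorentz_self,
        y.lorentz_self]
      have e1 : lorentz x.vec p.vec = -Real.cosh A := by linarith
      have e2 : lorentz y.vec p.vec = -Real.cosh B := by rw [lorentz_comm]; linarith
      have e3 : lorentz x.vec y.vec =
        -(Real.cosh A * Real.cosh B + Real.sinh A * Real.sinh B) := by linarith
      rw [lorentz_comm y.vec x.vec, e1, e2, e3]
      linear_combination Real.sinh B ^ 2 * hA2 + Real.sinh A ^ 2 * hB2
  have hw := congrArg (fun z => lorentz z w) hz
  simp only [lorentz_add_left, lorentz_smul_left, lorentz_zero_left, hx, hy] at hw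
  rw [lorentz_comm p.vec y.vec] at hB
  have : (Real.sinh A * Real.cosh B + Real.cosh A * Real.sinh B) * lorentz p.vec w = 0 := by
    rw [hA, hB]
    linarith
  exact (mul_eq_zero.mp this).resolve_left hs.ne'

theorem edist_add_edist_le_pathLength {x y : HyperbolicSpace n} (γ : Path x y)
    (t : unitInterval) : edist x (γ t) + edist (γ t) y ≤ pathLength γ := by
  have h := eVariationOn.Icc_add_Icc γ (s := Set.univ) (unitInterval.nonneg' (t := t))
    (unitInterval.le_one' (t := t)) (Set.mem_univ t)
  have h1 : edist x (γ t) ≤ eVariationOn γ (Set.univ ∩ Set.Icc 0 t) := by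
    have := eVariationOn.edist_le γ (s := Set.univ ∩ Set.Icc 0 t) (x := 0) (y := t)
      ⟨trivial, le_rfl, unitInterval.nonneg'⟩ ⟨trivial, unitInterval.nonneg', le_rfl⟩
    rwa [γ.source] at this
  have h2 : edist (γ t) y ≤ eVariationOn γ (Set.univ ∩ Set.Icc t 1) := by
    have := eVariationOn.edist_le γ (s := Set.univ ∩ Set.Icc t 1) (x := t) (y := 1)
      ⟨trivial, le_rfl, unitInterval.le_one'⟩ ⟨trivial, unitInterval.le_one', le_rfl⟩
    rwa [γ.target] at this
  refine (add_le_add h1 h2).trans (h.le.trans ?_)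
  exact eVariationOn.mono _ Set.inter_subset_left

/-- A shortest path between the endpoints of an edge, within the edge, covers the edge. -/
theorem RightAngledSystem.face_subset_range [DecidableEq (MinkowskiSpace n)]
    {U S : Finset (MinkowskiSpace n)} (hU : RightAngledSystem U) (hS : S ⊆ U)
    (hcard : S.card + 1 = n) {a : MinkowskiSpace n} (ha : a ∈ link U S) {x y : HyperbolicSpace n}
    (hx : x ∈ face U (insert a S)) (γ : Path x y) (hγ : ∀ t, γ t ∈ face U S)
    (hdist : ∀ p ∈ face U S, dist x p ≤ dist x y) : face U S ⊆ Set.range γ := by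
  intro p hp
  -- A point of the edge is determined by its distance from the endpoint `x`, and the path attains
  -- every intermediate distance.
  obtain ⟨t, ht⟩ := mem_range_of_exists_le_of_exists_ge
    (continuous_const.dist γ.continuous : Continuous fun t => dist x (γ t)) (c := dist x p)
    ⟨0, by simp [γ.source]⟩ ⟨1, by simpa [γ.target] using hdist p hp⟩
  replace ht : dist x (γ t) = dist x p := ht
  have hlor : lorentz (γ t).vec x.vec = lorentz p.vec x.vec := by
    have h1 := cosh_dist x (γ t)
    have h2 := cosh_dist x p
    rw [ht] at h1
    rw [lorentz_comm, lorentz_comm p.vec]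
    linarith
  have hdec : ∀ q ∈ face U S, q.vec = -lorentz q.vec x.vec • x.vec + lorentz q.vec a • a :=
    fun q hq => hU.edge_decomposition hS hcard ha hx hq.2
  have hsq : ∀ q ∈ face U S, lorentz q.vec a ^ 2 = lorentz q.vec x.vec ^ 2 - 1 := by
    intro q hq
    have h1 : lorentz q.vec q.vec = -lorentz q.vec x.vec * lorentz x.vec q.vec +
        lorentz q.vec a * lorentz a q.vec := by
      conv_lhs => rw [hdec q hq]
      rw [lorentz_add_left, lorentz_smul_left, lorentz_smul_left, ← hdec q hq]
    rw [q.lorentz_self, lorentz_comm x.vec, lorentz_comm a] at h1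
    linarith
  have haU := (mem_link.mp ha).1
  have hla : lorentz (γ t).vec a = lorentz p.vec a := by
    have h1 := hsq _ (hγ t)
    rw [hlor, ← hsq p hp] at h1
    have h2 := (hγ t).1 a haU
    have h3 := hp.1 a haU
    rcases sq_eq_sq_iff_eq_or_eq_neg.mp h1 with h | h
    · exact h
    · linarith
  refine ⟨t, HyperbolicSpace.ext ?_⟩
  rw [hdec _ (hγ t), hdec p hp, hlor, hla]

end HyperbolicSpace

/-! ### Proof of the theorem -/

theorem lemma3p1 (n : ℕ) (P : Set (HyperbolicSpace n))
    (hP : HyperbolicSpace.IsConvexPolytope P)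
    (hright : HyperbolicSpace.IsRightAngled P)
    (hreg : HyperbolicSpace.IsRegular P)
    (L : ℝ) (hL : ∃ E, HyperbolicSpace.IsEdge P E ∧ HyperbolicSpace.edgeLength E = L)
    (F F' : Set (HyperbolicSpace n))
    (hF : HyperbolicSpace.IsFacet P F) (hF' : HyperbolicSpace.IsFacet P F')
    (hFF' : F ∩ F' = ∅)
    (x y : HyperbolicSpace n) (hx : x ∈ F) (hy : y ∈ F')
    (γ : Path x y) (hγ : ∀ t, γ t ∈ P) :
    ENNReal.ofReal L ≤ HyperbolicSpace.pathLength γ ∧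
      (HyperbolicSpace.pathLength γ = ENNReal.ofReal L →
        HyperbolicSpace.IsEdge P (Set.range γ)) := by
  classical
  open HyperbolicSpace in
  obtain ⟨d, hd, hF⟩ := hF
  obtain ⟨d', hd', hF'⟩ := hF'
  obtain ⟨U, hU, rfl⟩ := exists_rightAngledSystem (by omega) hP hright
  have hL0 : 0 ≤ L := by
    obtain ⟨E, -, rfl⟩ := hL
    exact Metric.diam_nonneg
  have hLS : ∀ S ⊆ U, (face U S).Nonempty → S.card + 1 = n → Metric.diam (face U S) = L :=
    fun S hS hne hcard => hU.diam_edge_eq hreg hL hS hne hcard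
  obtain ⟨A, hA, rfl, hAcard⟩ := hU.exists_face_of_isFaceOfDim hF
  obtain ⟨B, hB, rfl, hBcard⟩ := hU.exists_face_of_isFaceOfDim hF'
  obtain ⟨a, rfl⟩ := Finset.card_eq_one.mp (show A.card = 1 by omega)
  obtain ⟨b, rfl⟩ := Finset.card_eq_one.mp (show B.card = 1 by omega)
  rw [Finset.singleton_subset_iff] at hA hB
  have hxa : lorentz x.vec a = 0 := hx.2 a (Finset.mem_singleton_self a)
  have hyb : lorentz y.vec b = 0 := hy.2 b (Finset.mem_singleton_self b)
  have hab : a ≠ b := by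
    rintro rfl
    exact Set.notMem_empty x (hFF' ▸ ⟨hx, hx⟩)
  have ha : a ∈ link U ∅ := mem_link.mpr ⟨hA, Finset.notMem_empty a, x, by simpa using hx⟩
  have hb : b ∈ link U ∅ := mem_link.mpr ⟨hB, Finset.notMem_empty b, y, by simpa using hy⟩
  have hya : lorentz y.vec a ≠ 0 := fun h =>
    Set.notMem_empty y (hFF' ▸ ⟨⟨hy.1, by simpa using h⟩, hy⟩)
  have hdisj : ¬ (face U (insert a (insert b ∅))).Nonempty := by
    rintro ⟨z, hz⟩
    exact Set.notMem_empty z (hFF' ▸ ⟨face_anti (by simp) hz, face_anti (by simp) hz⟩)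
  -- The descent starts from the whole polytope, whose dimension is `k + 1`.
  obtain ⟨hle, heq⟩ := hU.cosh_le_of_disjoint hreg hLS (Finset.empty_subset U) (k := n - 1)
    (by rw [Finset.card_empty]; omega) ha hb hab hdisj
  have hsq : lorentz a b ^ 2 ≤ lorentz x.vec y.vec ^ 2 :=
    (lorentz_sq_le_one_add y (hU.unit a hA) (hU.unit b hB) hyb).trans
      (one_add_sq_le_lorentz_sq x y (hU.unit a hA) hxa)
  have hneg := lorentz_vec_neg x y
  have hle' : -lorentz a b ≤ -lorentz x.vec y.vec :=
    le_of_sq_le_sq (by rwa [neg_sq, neg_sq]) (by linarith)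
  have hdist : L ≤ dist x y := by
    rw [← abs_of_nonneg hL0, ← abs_of_nonneg (dist_nonneg (x := x) (y := y)),
      ← Real.cosh_le_cosh, cosh_dist]
    exact hle.trans hle'
  have hlen := edist_add_edist_le_pathLength γ
  have hlen0 : edist x y ≤ pathLength γ := by
    have := hlen 0
    rwa [γ.source, edist_self, zero_add] at this
  rw [edist_dist] at hlen0
  refine ⟨(ENNReal.ofReal_le_ofReal hdist).trans hlen0, fun hlenL => ?_⟩
  have hxyL : dist x y = L := by
    rw [hlenL, ENNReal.ofReal_le_ofReal_iff hL0] at hlen0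
    exact hlen0.antisymm hdist
  have hxy : x ≠ y := by
    rintro rfl
    exact hya hxa
  have hcosh : -lorentz x.vec y.vec = Real.cosh L := by rw [← cosh_dist, hxyL]
  -- Now `cosh L ≤ -⟨a, b⟩ ≤ cosh (dist x y) = cosh L`, so all equality cases apply.
  have hab_eq : -lorentz a b = Real.cosh L := by linarith
  obtain ⟨S, hS, hcard, haS, hbS⟩ := heq hab_eq
  have hxyS : ∀ w ∈ S, lorentz x.vec w = 0 ∧ lorentz y.vec w = 0 := fun w hw =>
    lorentz_eq_zero_of_dist_eq x y (hU.unit a hA) (hU.unit b hB) hxa hyb hya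
      (by rw [← neg_sq, hcosh, ← hab_eq, neg_sq]) (hU.link_orthogonal hS haS hw)
      (hU.link_orthogonal hS hbS hw)
  have hγS : ∀ t, γ t ∈ face U S := by
    intro t
    refine ⟨(hγ t).1, fun w hw => ?_⟩
    refine lorentz_eq_zero_of_dist_add_dist x y (γ t) hxy ?_ (hxyS w hw).1 (hxyS w hw).2
    apply le_antisymm _ (dist_triangle _ _ _)
    have := hlen t
    rw [hlenL, edist_dist, edist_dist, ← ENNReal.ofReal_add dist_nonneg dist_nonneg,
      ENNReal.ofReal_le_ofReal_iff hL0] at this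
    rwa [hxyL]
  have hxS : x ∈ face U (insert a S) :=
    mem_face_insert.mpr ⟨⟨hx.1, fun w hw => (hxyS w hw).1⟩, hxa⟩
  have hne : (face U S).Nonempty := ⟨x, face_anti (Finset.subset_insert _ _) hxS⟩
  have hrange : Set.range γ = face U S := by
    apply Set.Subset.antisymm
    · rintro _ ⟨t, rfl⟩
      exact hγS t
    · refine hU.face_subset_range hS hcard haS hxS γ hγS fun p hp => ?_
      rw [hxyL, ← hLS S hS hne hcard]
      exact Metric.dist_le_diam_of_mem (hP.2.1.subset (face_anti (Finset.empty_subset _)))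
        (face_anti (Finset.subset_insert _ _) hxS) hp
  rw [hrange]
  exact hU.isFaceOfDim_face hS hne (by omega)
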